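/- Let $q\in(0,1)$, $\theta>0$, $L\ge 1$ and $\alpha\in(0,q^{-1-\theta})$. Write $\{a\}_{Q}=\frac{1-Q^{a}}{1-Q}$, $[a]_q=\frac{q^a-q^{-a}}{q-q^{-1}}$, $[m]_q!=\prod_{k=1}^m[k]_q$, $\binom{m+\theta-1}{m}_q=\frac{[\theta]_q[\theta+1]_q\cdots[\theta+m-1]_q}{[m]_q!}$, $(a;Q)_k=\prod_{j=0}^{k-1}(1-aQ^j)$, $(a;Q)_\infty=\prod_{j\ge0}(1-aQ^j)$. For $x\in\mathbb N^L$ (with $\mathbb N=\{0,1,\dots\}$) put $N(x)=\sum_{m=1}^L x_m$, $N^-_{i-1}(x)=\sum_{m<i}x_m$, $N^+_{i+1}(x)=\sum_{m>i}x_m$, and, if $x_i>0$, let $x^{i,j}$ be $x$ with one particle moved from site $i$ to site $j$ (terms containing $x^{i,j}$ with $x_i=0$ have rate zero and are read as $0$). The process ASIP$(q,\theta)$ on $\Lambda_L=\{1,\dots,L\}$ is the continuous-time Markov process on $\mathbb N^L$ with generator $$[\mathcal Lf](x)=\sum_{i=1}^{L-1}\Big(q^{2\theta-1}\{x_i\}_{q^2}\{\theta+x_{i+1}\}_{q^{-2}}\,[f(x^{i,i+1})-f(x)]+q^{-2\theta+1}\{x_{i+1}\}_{q^{-2}}\{\theta+x_i\}_{q^{2}}\,[f(x^{i+1,i})-f(x)]\Big)$$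 (there is exactly one Markov transition semigroup with this generator). Define the $q$-Meixner polynomials $$M_n(Q^{-x};b,c;Q)=\sum_{k\ge0}\frac{(Q^{-x};Q)_k\,(Q^{-n};Q)_k}{(bQ;Q)_k\,(Q;Q)_k}\Big(-\frac{Q^{n+1}}{c}\Big)^k$$ and, for $x,n\in\mathbb N^L$, $$D_\alpha(x,n)=\prod_{i=1}^L M_{n_i}\big(q^{-2x_i};q^{2(\theta-1)},c_{i,\alpha}(x,n);q^2\big),\qquad c_{i,\alpha}(x,n)=\alpha\,q^{2(N^-_{i-1}(x)-N^+_{i+1}(n))+\theta(2i-1)+1}.$$ Then ASIP$(q,\theta)$ is self-dual with self-duality function $D_\alpha$: if $X$ and $\widehat X$ are two copies of the process, then for all $x,n\in\mathbb N^L$ and $t>0$ $$\mathbb E_x\big[D_\alpha(X_t,n)\big]=\widehat{\mathbb E}_n\big[D_\alpha(x,\widehat X_t)\big],$$ where both expectations are of integrable random variables. Moreover, let $$\mu_\alpha(x)=\prod_{i=1}^L\alpha^{x_i}\binom{x_i+\theta-1}{x_i}_q q^{2\theta i x_i},\qquad w_\alpha(x)=\mu_\alpha(x)\,q^{N(x)(N(x)-1)}\,(-\alpha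 q^{1+2N(x)+\theta(2L+1)};q^2)_\infty,$$ $$\mathcal Z_\alpha=\sum_{x\in\mathbb N^L}w_\alpha(x),\qquad \omega_\alpha(x)=\frac{w_\alpha(x)}{\mathcal Z_\alpha},$$ $$g_{\alpha,1}(x)=\frac{q^{2N(x)(N(x)-1)}}{\mathcal Z_\alpha^2}\,(-\alpha q^{1+2N(x)+\theta(2L+1)};q^2)_\infty\,(-\alpha q^{1-2N(x)+\theta};q^2)_\infty.$$ Then $\omega_\alpha$ is a probability measure on $\mathbb N^L$ with $\omega_\alpha(x)>0$ for every $x$, and for all $x,n\in\mathbb N^L$, with absolute convergence of the sum, $$\sum_{y\in\mathbb N^L}D_\alpha(y,x)\,D_\alpha(y,n)\,\omega_\alpha(y)=\delta_{x,n}\,\frac{g_{\alpha,1}(x)}{\omega_\alpha(x)} .$$ -/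

import Mathlib

open MeasureTheory ProbabilityTheory Filter
open scoped Topology NNReal

namespace ASIP

noncomputable section

/-! ### q-calculus -/

/-- The number `{a}_Q = (1 - Q ^ a) / (1 - Q)`, used with bases `Q = q ^ 2` and `Q = q ^ (-2)`. -/
def curlyNum (Q a : ℝ) : ℝ := (1 - Q ^ a) / (1 - Q)

/-- The symmetric q-number `[a]_q = (q ^ a - q ^ (-a)) / (q - q ^ (-1))`. -/
def bracketNum (q a : ℝ) : ℝ := (q ^ a - q ^ (-a)) / (q - q⁻¹)

/-- The q-factorial `[n]_q! = [n]_q [n-1]_q ⋯ [1]_q`. -/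
def qFactorial (q : ℝ) (n : ℕ) : ℝ := ∏ k ∈ Finset.range n, bracketNum q ((k : ℝ) + 1)

/-- The q-binomial coefficient `binom(m + θ - 1, m)_q = [θ+m-1]_q ⋯ [θ]_q / [m]_q!`
for real `θ > 0`. -/
def qBinom (q θ : ℝ) (m : ℕ) : ℝ :=
  (∏ k ∈ Finset.range m, bracketNum q (θ + k)) / qFactorial q m

/-- The q-Pochhammer symbol `(a; Q)_m`. -/
def qPoch (a Q : ℝ) (m : ℕ) : ℝ := ∏ k ∈ Finset.range m, (1 - a * Q ^ k)

/-- The infinite q-Pochhammer symbol `(a; Q)_∞` (used for `0 < Q < 1`, where it converges). -/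
def qPochInf (a Q : ℝ) : ℝ := ∏' k : ℕ, (1 - a * Q ^ k)

/-- The basic hypergeometric series `₂φ₁(a, b; c; Q, z)`. -/
def phi21 (a b c Q z : ℝ) : ℝ :=
  ∑' k : ℕ, qPoch a Q k * qPoch b Q k / qPoch c Q k * (z ^ k / qPoch Q Q k)

/-- The q-Meixner polynomial `M_n(y; b, c; Q) = ₂φ₁(y, Q^{-n}; bQ; Q, -Q^{n+1}/c)`,
evaluated at `y = Q^{-x}` below. -/
def qMeixner (n : ℕ) (y b c Q : ℝ) : ℝ :=
  phi21 y (Q ^ (-(n : ℤ))) (b * Q) Q (-(Q ^ (n + 1) / c))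

/-! ### Configurations, generator -/

/-- Particle configurations on `{1, …, L}`; the site with label `k` is the index `i : Fin L` with `i.val + 1 = k`. -/
abbrev Config (L : ℕ) : Type := Fin L → ℕ

variable {L : ℕ}

/-- Total number of particles `N(x)`. -/
def mass (x : Config L) : ℕ := ∑ m, x m

/-- Number of particles strictly to the left of site `i`, `N⁻_{i-1}(x)`. -/
def massLeft (x : Config L) (i : Fin L) : ℕ := ∑ m ∈ Finset.univ.filter (fun m => m < i), x m

/-- Number of particles strictly to the right of site `i`, `N⁺_{i+1}(x)`. -/
def massRight (x : Config L) (i : Fin L) : ℕ := ∑ m ∈ Finset.univ.filter (fun m => i < m), x m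

/-- The configuration `x^{i,j}` (`i ≠ j`): one particle is moved from `i` to `j`. It is meaningful
if `x i > 0`; in the generator it is multiplied by a rate that vanishes when `x i = 0`. -/
def move (x : Config L) (i j : Fin L) : Config L :=
  Function.update (Function.update x i (x i - 1)) j (x j + 1)

/-- The generator of ASIP(q, θ) on the bond `(i, j)`, `j` being the right neighbour of `i`. -/
def bondGenerator (q θ : ℝ) (i j : Fin L) (f : Config L → ℝ) (x : Config L) : ℝ :=
  q ^ (2 * θ - 1) * curlyNum (q ^ (2 : ℤ)) (x i) * curlyNum (q ^ (-2 : ℤ)) (θ + x j)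
      * (f (move x i j) - f x)
    + q ^ (-2 * θ + 1) * curlyNum (q ^ (-2 : ℤ)) (x j) * curlyNum (q ^ (2 : ℤ)) (θ + x i)
      * (f (move x j i) - f x)

/-- The generator of ASIP(q, θ) with closed boundary conditions: sum over the bonds
of nearest neighbours. -/
def generator (q θ : ℝ) (f : Config L → ℝ) (x : Config L) : ℝ :=
  ∑ i : Fin L, if h : i.val + 1 < L then bondGenerator q θ i ⟨i.val + 1, h⟩ f x else 0

/-! ### Markov processes on a countable state space and duality -/

section Markov

variable {E : Type*} [MeasurableSpace E]

/-- `κ` is a (conservative) Markov transition semigroup whose infinitesimal generator is `𝓛`: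
for finitely supported `f` (equivalently, for the transition probabilities between any two states)
the right derivative of `t ↦ ∫ f dκ_t(x, ·)` at `0` is `𝓛 f x`. -/
structure IsTransitionSemigroup (𝓛 : (E → ℝ) → E → ℝ) (κ : ℝ≥0 → Kernel E E) : Prop where
  markov : ∀ t, IsMarkovKernel (κ t)
  zero : κ 0 = Kernel.id
  add : ∀ s t, κ (s + t) = κ t ∘ₖ κ s
  generator : ∀ f : E → ℝ, (Function.support f).Finite → ∀ x,
    Tendsto (fun t : ℝ≥0 => (∫ y, f y ∂(κ t x) - f x) / (t : ℝ)) (𝓝[≠] 0) (𝓝 (𝓛 f x))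

/-- `(X_t)` under the family of laws `(P x)` is a time-homogeneous Markov process with transition
semigroup `κ` and `X_0 = x` a.s. under `P x`. The event `A` ranges over the past
`σ(X_u : u ≤ s)`. -/
structure IsMarkovProcess {Ω : Type*} [MeasurableSpace Ω] (κ : ℝ≥0 → Kernel E E)
    (P : E → Measure Ω) (X : ℝ≥0 → Ω → E) : Prop where
  prob : ∀ x, IsProbabilityMeasure (P x)
  measurable : ∀ t, Measurable (X t)
  start : ∀ x, ∀ᵐ ω ∂(P x), X 0 ω = x
  markov : ∀ (x : E) (s t : ℝ≥0) (A : Set Ω),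
    MeasurableSet[⨆ u : Set.Iic s, MeasurableSpace.comap (X u) inferInstance] A →
    ∀ (y : E) (B : Set E), MeasurableSet B →
      P x (A ∩ X s ⁻¹' {y} ∩ X (s + t) ⁻¹' B) = P x (A ∩ X s ⁻¹' {y}) * κ t y B

/-- Duality of two Markov processes with respect to `D`:
`E_x[D(X_t, n)] = Ê_n[D(x, X̂_t)]` for all `x`, `n`, `t > 0`, all expectations being finite. -/
def AreDual {E' Ω Ω' : Type*} [MeasurableSpace Ω] [MeasurableSpace Ω']
    (P : E → Measure Ω) (X : ℝ≥0 → Ω → E) (P' : E' → Measure Ω') (X' : ℝ≥0 → Ω' → E')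
    (D : E → E' → ℝ) : Prop :=
  ∀ (x : E) (n : E') (t : ℝ≥0), 0 < t →
    Integrable (fun ω => D (X t ω) n) (P x) ∧ Integrable (fun ω => D x (X' t ω)) (P' n) ∧
      ∫ ω, D (X t ω) n ∂(P x) = ∫ ω, D x (X' t ω) ∂(P' n)

/-- Self-duality expressed through the transition semigroup; `κ t x` is the law at time `t` of
the process started at `x`. -/
def SemigroupSelfDual (κ : ℝ≥0 → Kernel E E) (D : E → E → ℝ) : Prop :=
  ∀ (x n : E) (t : ℝ≥0), 0 < t →
    Integrable (fun y => D y n) (κ t x) ∧ Integrable (fun m => D x m) (κ t n) ∧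
      ∫ y, D y n ∂(κ t x) = ∫ m, D x m ∂(κ t n)

end Markov

/-! ### Duality functions and measures -/

/-- `c_{i,α}(x, n) = α q^{2(N⁻_{i-1}(x) - N⁺_{i+1}(n)) + θ(2i-1) + 1}`; as sites are numbered from
`0` here, `2i - 1` becomes `2 i.val + 1`. -/
def cParam (q θ α : ℝ) (x n : Config L) (i : Fin L) : ℝ :=
  α * q ^ (2 * ((massLeft x i : ℝ) - (massRight n i : ℝ)) + θ * (2 * (i.val : ℝ) + 1) + 1)

/-- The nested product of q-Meixner polynomials
`D_α(x, n) = ∏_i M_{n_i}(q^{-2 x_i}; q^{2(θ-1)}, c_{i,α}(x, n); q²)`. -/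
def dualityFn (q θ α : ℝ) (x n : Config L) : ℝ :=
  ∏ i, qMeixner (n i) (q ^ (-2 * (x i : ℤ))) (q ^ (2 * (θ - 1))) (cParam q θ α x n i) (q ^ 2)

/-- The product measure `μ_α(x) = ∏_i α^{x_i} binom(x_i + θ - 1, x_i)_q q^{2 θ i x_i}`. -/
def mu (q θ α : ℝ) (x : Config L) : ℝ :=
  ∏ i : Fin L, α ^ (x i) * qBinom q θ (x i) * q ^ (2 * θ * ((i.val : ℝ) + 1) * (x i : ℝ))

/-- The factor `(-α q^{1 + 2N(x) + θ(2L+1)}; q²)_∞`. -/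
def pochX (q θ α : ℝ) (x : Config L) : ℝ :=
  qPochInf (-α * q ^ (1 + 2 * (mass x : ℝ) + θ * (2 * (L : ℝ) + 1))) (q ^ 2)

/-- The factor `(-α q^{1 - 2N(x) + θ}; q²)_∞`. -/
def pochN (q θ α : ℝ) (x : Config L) : ℝ :=
  qPochInf (-α * q ^ (1 - 2 * (mass x : ℝ) + θ)) (q ^ 2)

/-- The unnormalised weight `μ_α(x) q^{N(x)(N(x)-1)} (-α q^{1 + 2N(x) + θ(2L+1)}; q²)_∞`. -/
def weight (q θ α : ℝ) (x : Config L) : ℝ :=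
  mu q θ α x * q ^ ((mass x : ℝ) * ((mass x : ℝ) - 1)) * pochX q θ α x

/-- The normalising constant `Z_α`. -/
def partitionFn (q θ α : ℝ) (L : ℕ) : ℝ := ∑' x : Config L, weight q θ α x

/-- The reversible probability measure `ω_α`, given by its weights. -/
def omega (q θ α : ℝ) (x : Config L) : ℝ := weight q θ α x / partitionFn q θ α L

/-- The function `g_{α,1}`. -/
def gFn (q θ α : ℝ) (x : Config L) : ℝ :=
  q ^ (2 * (mass x : ℝ) * ((mass x : ℝ) - 1)) / partitionFn q θ α L ^ 2
    * pochX q θ α x * pochN q θ α x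

end

end ASIP

namespace ASIP

/-! ### q-shifted factorials -/

/-! Write Q = q² and c = q^{2θ}. Each factor of the duality function is a terminating ₂φ₁ with upper
parameters Q^{-x_i}, Q^{-n_i} and lower parameter c, and a jump across a bond changes only the two
factors at its ends. Duality of the generators thus reduces to one two-site identity,
`phi21_two_site`. Contiguous relations express the generator acting on the x-variables through the
two ₂φ₁ at two arguments each. A ₂φ₁ is symmetric in its upper parameters, so the action on the
n-variables has the same form, and the two expressions agree by a rational identity. Jumps conserve
mass, so the generator is a finite rate matrix on each mass class and the semigroup consists of
matrix exponentials. Generator duality is an intertwining of matrices, which passes to exponentials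
(`exp_mul_eq_mul_exp`, `IsFiberGenerator.semigroupSelfDual`). For uniqueness, a competing semigroup
restricted to a class is substochastic and supermultiplicative; a Chernoff limit shows that it
dominates the exponential, which already has full mass (`IsFiberGenerator.eq_fiberKernel`).
Orthogonality is proved by induction on the number of sites (`hasSum_dualityFn_mul`). Given the
other sites, the weight in the last coordinate is a q-Meixner weight, so one-variable orthogonality
applies. The infinite product in its squared norm restores the weight on the remaining sites with α
replaced by α/Q^l, which is also the parameter of the remaining factors. In one variable
(`hasSum_meixner_mul_meixner`), suitable monic polynomials in Q^{-y} shift c to c/Q^j in the weight.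
The ₁φ₁ and q-binomial sums then give a multiple of (Q^{-j};Q)_n, which vanishes for j < n. -/

lemma qPoch_zero (a Q : ℝ) : qPoch a Q 0 = 1 := by simp [qPoch]

lemma qPoch_succ (a Q : ℝ) (k : ℕ) : qPoch a Q (k + 1) = qPoch a Q k * (1 - a * Q ^ k) := by
  simp [qPoch, Finset.prod_range_succ]

lemma qPoch_succ' (a Q : ℝ) (k : ℕ) : qPoch a Q (k + 1) = (1 - a) * qPoch (a * Q) Q k := by
  rw [qPoch, Finset.prod_range_succ', qPoch, mul_comm]
  congr 1
  · simp
  · exact Finset.prod_congr rfl fun i _ => by ring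

lemma qPoch_pos {a Q : ℝ} (hQ0 : 0 < Q) (hQ1 : Q < 1) (ha1 : a < 1) (k : ℕ) :
    0 < qPoch a Q k := by
  refine Finset.prod_pos fun i _ => ?_
  have h1 : Q ^ i ≤ 1 := pow_le_one₀ hQ0.le hQ1.le
  have h2 : 0 < Q ^ i := pow_pos hQ0 i
  rcases le_total a 0 with h | h <;> nlinarith

lemma qPoch_zpow_neg_eq_zero {Q : ℝ} (hQ : Q ≠ 0) {n k : ℕ} (h : n < k) :
    qPoch (Q ^ (-(n : ℤ))) Q k = 0 := by
  refine Finset.prod_eq_zero (Finset.mem_range.2 h) ?_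
  rw [zpow_neg, zpow_natCast, inv_mul_cancel₀ (pow_ne_zero _ hQ), sub_self]

lemma qPoch_mul_shift (a Q : ℝ) (k : ℕ) :
    (1 - a) * qPoch (a * Q) Q k = qPoch a Q k * (1 - a * Q ^ k) := by
  rw [← qPoch_succ', qPoch_succ]

/-! ### Contiguous relations for terminating `₂φ₁` -/

/-- The coefficients of the basic hypergeometric series `₂φ₁`. -/
noncomputable def phiCoeff (a b c Q : ℝ) (k : ℕ) : ℝ :=
  qPoch a Q k * qPoch b Q k / qPoch c Q k / qPoch Q Q k

lemma phi21_eq_tsum (a b c Q z : ℝ) : phi21 a b c Q z = ∑' k, phiCoeff a b c Q k * z ^ k := by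
  refine tsum_congr fun k => ?_
  rw [phiCoeff]; ring

lemma phi21_comm (a b c Q z : ℝ) : phi21 a b c Q z = phi21 b a c Q z := by
  simp only [phi21, mul_comm (qPoch a Q _)]

lemma phiCoeff_eq_zero {a c Q : ℝ} (hQ : Q ≠ 0) {n k : ℕ} (h : n < k) :
    phiCoeff a (Q ^ (-(n : ℤ))) c Q k = 0 := by
  rw [phiCoeff, qPoch_zpow_neg_eq_zero hQ h, mul_zero, zero_div, zero_div]

lemma phi21_eq_sum {a c Q z : ℝ} (hQ : Q ≠ 0) (n : ℕ) :
    phi21 a (Q ^ (-(n : ℤ))) c Q z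
      = ∑ k ∈ Finset.range (n + 1), phiCoeff a (Q ^ (-(n : ℤ))) c Q k * z ^ k := by
  rw [phi21_eq_tsum]
  refine tsum_eq_sum fun k hk => ?_
  rw [phiCoeff_eq_zero hQ (by simpa using hk), zero_mul]

lemma summable_phiCoeff_mul {a c Q : ℝ} (hQ : Q ≠ 0) (n : ℕ) (f : ℕ → ℝ) :
    Summable fun k => phiCoeff a (Q ^ (-(n : ℤ))) c Q k * f k := by
  refine summable_of_ne_finset_zero (s := Finset.range (n + 1)) fun k hk => ?_
  rw [phiCoeff_eq_zero hQ (by simpa using hk), zero_mul]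

/-- Termwise this is (1 - a)(aQ;Q)_k = (a;Q)_k (1 - aQ^k), since the dilation z ↦ Qz multiplies the
k-th term by Q^k. With a = Q^{-x} it lowers x by one. -/
lemma phi21_lower {a c Q z : ℝ} (hQ : Q ≠ 0) (n : ℕ) :
    (1 - a) * phi21 (a * Q) (Q ^ (-(n : ℤ))) c Q z
      = phi21 a (Q ^ (-(n : ℤ))) c Q z - a * phi21 a (Q ^ (-(n : ℤ))) c Q (Q * z) := by
  simp only [phi21_eq_tsum, ← tsum_mul_left]
  rw [← (summable_phiCoeff_mul hQ n _).tsum_sub ((summable_phiCoeff_mul hQ n _).mul_left a)]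
  refine tsum_congr fun k => ?_
  have := qPoch_mul_shift a Q k
  simp only [phiCoeff, mul_pow]
  linear_combination (qPoch (Q ^ (-(n : ℤ))) Q k / qPoch c Q k / qPoch Q Q k * z ^ k) * this

/-- Both sides factor on the level of coefficients: the left into (1 - aQ^k)(1 - bQ^k) z^{k+1}, the
right into (1 - Q^k)(1 - cQ^{k-1}) z^k. The right has no term at k = 0, and shifting its index gives
the ratio of consecutive coefficients. -/
lemma phi21_qDifference {a c Q z : ℝ} (hQ0 : 0 < Q) (hQ1 : Q < 1) (hc : c < 1) (n : ℕ) :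
    z * (phi21 a (Q ^ (-(n : ℤ))) c Q z
        - (a + Q ^ (-(n : ℤ))) * phi21 a (Q ^ (-(n : ℤ))) c Q (Q * z)
        + a * Q ^ (-(n : ℤ)) * phi21 a (Q ^ (-(n : ℤ))) c Q (Q * (Q * z)))
      = phi21 a (Q ^ (-(n : ℤ))) c Q z - (1 + c / Q) * phi21 a (Q ^ (-(n : ℤ))) c Q (Q * z)
        + c / Q * phi21 a (Q ^ (-(n : ℤ))) c Q (Q * (Q * z)) := by
  have hS := summable_phiCoeff_mul (a := a) (c := c) hQ0.ne' n
  set b := Q ^ (-(n : ℤ)) with hb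
  have e1 : z * (phi21 a b c Q z - (a + b) * phi21 a b c Q (Q * z)
        + a * b * phi21 a b c Q (Q * (Q * z)))
      = ∑' k, phiCoeff a b c Q k * ((1 - a * Q ^ k) * (1 - b * Q ^ k) * z ^ (k + 1)) := by
    simp only [phi21_eq_tsum, ← tsum_mul_left]
    rw [← (hS _).tsum_sub ((hS _).mul_left _),
      ← ((hS _).sub ((hS _).mul_left _)).tsum_add ((hS _).mul_left _), ← tsum_mul_left]
    exact tsum_congr fun k => by ring
  have e2 : phi21 a b c Q z - (1 + c / Q) * phi21 a b c Q (Q * z)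
        + c / Q * phi21 a b c Q (Q * (Q * z))
      = ∑' k, phiCoeff a b c Q k * ((1 - Q ^ k) * (1 - c / Q * Q ^ k) * z ^ k) := by
    simp only [phi21_eq_tsum, ← tsum_mul_left]
    rw [← (hS _).tsum_sub ((hS _).mul_left _),
      ← ((hS _).sub ((hS _).mul_left _)).tsum_add ((hS _).mul_left _)]
    exact tsum_congr fun k => by ring
  rw [e1, e2, (hS fun k => (1 - Q ^ k) * (1 - c / Q * Q ^ k) * z ^ k).tsum_eq_zero_add]
  simp only [pow_zero, sub_self, zero_mul, mul_zero, zero_add]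
  refine tsum_congr fun k => ?_
  have h1 := (qPoch_pos hQ0 hQ1 hc k).ne'
  have h2 := (qPoch_pos hQ0 hQ1 hQ1 k).ne'
  have h3 := (qPoch_pos hQ0 hQ1 hc (k + 1)).ne'
  have h4 := (qPoch_pos hQ0 hQ1 hQ1 (k + 1)).ne'
  have e3 : c / Q * Q ^ (k + 1) = c * Q ^ k := by rw [pow_succ']; field_simp
  simp only [phiCoeff]
  rw [e3]
  rw [qPoch_succ] at h3 h4
  simp only [qPoch_succ]
  have h5 := right_ne_zero_of_mul h3
  have h6 := right_ne_zero_of_mul h4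
  have e4 : 1 - Q ^ (k + 1) = 1 - Q * Q ^ k := by ring
  rw [e4]
  generalize 1 - c * Q ^ k = d₁ at *
  generalize 1 - Q * Q ^ k = d₂ at *
  field_simp

lemma phi21_lower_inv {X c Q z : ℝ} (hQ : Q ≠ 0) (hX : X ≠ 0) (n : ℕ) :
    (1 - X) * phi21 (X / Q)⁻¹ (Q ^ (-(n : ℤ))) c Q z
      = phi21 X⁻¹ (Q ^ (-(n : ℤ))) c Q (Q * z) - X * phi21 X⁻¹ (Q ^ (-(n : ℤ))) c Q z := by
  have h := phi21_lower (a := X⁻¹) (c := c) (z := z) hQ n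
  rw [show X⁻¹ * Q = (X / Q)⁻¹ by field_simp] at h
  generalize phi21 (X / Q)⁻¹ (Q ^ (-(n : ℤ))) c Q z = u at *
  generalize phi21 X⁻¹ (Q ^ (-(n : ℤ))) c Q z = v at *
  generalize phi21 X⁻¹ (Q ^ (-(n : ℤ))) c Q (Q * z) = w at *
  field_simp at h
  linear_combination -h

/-- Raising the first parameter at fixed argument. -/
lemma phi21_raise_inv {X c Q z : ℝ} (hQ0 : 0 < Q) (hQ1 : Q < 1) (hc : c < 1) (hX : X ≠ 0)
    (hX1 : Q * X ≠ 1) (n : ℕ) :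
    Q * X * (1 - c * X) * phi21 (Q * X)⁻¹ (Q ^ (-(n : ℤ))) c Q z
      = (Q * X + c * X - Q * c * X ^ 2 - z) * phi21 X⁻¹ (Q ^ (-(n : ℤ))) c Q z
        + (z * Q ^ (-(n : ℤ)) - c * X) * phi21 X⁻¹ (Q ^ (-(n : ℤ))) c Q (Q * z) := by
  have hQ := hQ0.ne'
  have r1 := phi21_lower (a := (Q * X)⁻¹) (c := c) (z := z) hQ n
  have r2 := phi21_lower (a := (Q * X)⁻¹) (c := c) (z := Q * z) hQ n
  have r3 := phi21_qDifference (a := (Q * X)⁻¹) (z := z) hQ0 hQ1 hc n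
  rw [show (Q * X)⁻¹ * Q = X⁻¹ by field_simp] at r1 r2
  have hp1 : 1 - (Q * X)⁻¹ ≠ 0 := by
    rw [sub_ne_zero]; exact fun h => hX1 (inv_eq_one.1 h.symm)
  -- After this multiplication the lowering relation writes the unraised series through the raised
  -- one at z, Qz and Q²z; what remains is the q-difference equation of the raised series.
  refine mul_left_cancel₀ hp1 ?_
  generalize Q ^ (-(n : ℤ)) = b at *
  generalize phi21 X⁻¹ b c Q z = u at *
  generalize phi21 X⁻¹ b c Q (Q * z) = uQ at *
  generalize phi21 (Q * X)⁻¹ b c Q z = v at *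
  generalize phi21 (Q * X)⁻¹ b c Q (Q * z) = vQ at *
  generalize phi21 (Q * X)⁻¹ b c Q (Q * (Q * z)) = vQQ at *
  have key : (1 - (Q * X)⁻¹) * (Q * X * (1 - c * X) * v)
      - ((Q * X + c * X - Q * c * X ^ 2 - z) * (v - (Q * X)⁻¹ * vQ)
        + (z * b - c * X) * (vQ - (Q * X)⁻¹ * vQQ))
      = (z * (v - ((Q * X)⁻¹ + b) * vQ + (Q * X)⁻¹ * b * vQQ))
        - (v - (1 + c / Q) * vQ + c / Q * vQQ) := by
    field_simp
    ring
  linear_combination key + r3 - (Q * X + c * X - Q * c * X ^ 2 - z) * r1 - (z * b - c * X) * r2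

/-- Raising the first parameter with a shift of the argument. -/
lemma phi21_raise_shift_inv {X c Q z : ℝ} (hQ0 : 0 < Q) (hQ1 : Q < 1) (hc : c < 1) (hX : X ≠ 0)
    (hX1 : Q * X ≠ 1) (n : ℕ) :
    (1 - c * X) * phi21 (Q * X)⁻¹ (Q ^ (-(n : ℤ))) c Q (Q * z)
      = (1 + z * X * Q ^ (-(n : ℤ)) - Q * X - c * X) * phi21 X⁻¹ (Q ^ (-(n : ℤ))) c Q z
        + X * (Q - z) * phi21 X⁻¹ (Q ^ (-(n : ℤ))) c Q (z / Q) := by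
  have hQ := hQ0.ne'
  have r1 := phi21_lower (a := (Q * X)⁻¹) (c := c) (z := z) hQ n
  have r2 := phi21_raise_inv (z := z) hQ0 hQ1 hc hX hX1 n
  have r3 := phi21_qDifference (a := X⁻¹) (z := z / Q) hQ0 hQ1 hc n
  rw [show (Q * X)⁻¹ * Q = X⁻¹ by field_simp] at r1
  rw [show Q * (z / Q) = z by field_simp] at r3
  generalize Q ^ (-(n : ℤ)) = b at *
  generalize phi21 X⁻¹ b c Q z = u at *
  generalize phi21 X⁻¹ b c Q (Q * z) = uQ at *
  generalize phi21 X⁻¹ b c Q (z / Q) = w at *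
  generalize phi21 (Q * X)⁻¹ b c Q z = v at *
  generalize phi21 (Q * X)⁻¹ b c Q (Q * z) = vQ at *
  -- The three brackets on the right are the lowering relation, the raising relation, and the
  -- q-difference equation at z/Q; each is zero.
  have key : (1 - c * X) * vQ - ((1 + z * X * b - Q * X - c * X) * u + X * (Q - z) * w)
      = Q * X * (1 - c * X) * ((1 - (Q * X)⁻¹) * u - (v - (Q * X)⁻¹ * vQ))
        + (Q * X * (1 - c * X) * v - ((Q * X + c * X - Q * c * X ^ 2 - z) * u
          + (z * b - c * X) * uQ))
        + X * Q * (z / Q * (w - (X⁻¹ + b) * u + X⁻¹ * b * uQ)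
          - (w - (1 + c / Q) * u + c / Q * uQ)) := by
    field_simp
    ring
  linear_combination key + Q * X * (1 - c * X) * r1 + r2 + X * Q * r3

/-! ### Two-site duality relation -/

/-- The action of the (rescaled) two-site generator on the first arguments `X₁ = Q ^ x₁`,
`X₂ = Q ^ x₂` of a nested product of two `₂φ₁`'s, in a form symmetric in `X` and `N`. -/
lemma phi21_two_site_aux {X₁ X₂ c Q s z : ℝ} (hQ0 : 0 < Q) (hQ1 : Q < 1) (hc0 : 0 < c)
    (hc1 : c < 1) (hX₁ : X₁ ≠ 0) (hX₂ : X₂ ≠ 0) (hX₁' : Q * X₁ ≠ 1) (hX₂' : Q * X₂ ≠ 1)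
    (n₁ n₂ : ℕ) {N₁ N₂ : ℝ} (hN₁ : N₁⁻¹ = Q ^ (-(n₁ : ℤ))) (hN₂ : N₂⁻¹ = Q ^ (-(n₂ : ℤ))) :
    (1 - X₁) * (1 - c * X₂) *
        (phi21 (X₁ / Q)⁻¹ N₁⁻¹ c Q s * phi21 (Q * X₂)⁻¹ N₂⁻¹ c Q (Q * z))
      + Q / c * ((1 - X₂) * (1 - c * X₁)) *
        (phi21 (Q * X₁)⁻¹ N₁⁻¹ c Q s * phi21 (X₂ / Q)⁻¹ N₂⁻¹ c Q (z / Q))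
      = (phi21 X₁⁻¹ N₁⁻¹ c Q (Q * s) - X₁ * phi21 X₁⁻¹ N₁⁻¹ c Q s)
          * ((1 + z * X₂ * N₂⁻¹ - Q * X₂ - c * X₂) * phi21 X₂⁻¹ N₂⁻¹ c Q z
            + X₂ * (Q - z) * phi21 X₂⁻¹ N₂⁻¹ c Q (z / Q))
        + 1 / (c * X₁) * ((Q * X₁ + c * X₁ - Q * c * X₁ ^ 2 - s) * phi21 X₁⁻¹ N₁⁻¹ c Q s
            + (s * N₁⁻¹ - c * X₁) * phi21 X₁⁻¹ N₁⁻¹ c Q (Q * s))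
          * (phi21 X₂⁻¹ N₂⁻¹ c Q z - X₂ * phi21 X₂⁻¹ N₂⁻¹ c Q (z / Q)) := by
  have e1 := phi21_lower_inv (c := c) (z := s) hQ0.ne' hX₁ n₁
  have e2 := phi21_raise_shift_inv (z := z) hQ0 hQ1 hc1 hX₂ hX₂' n₂
  have e3 := phi21_raise_inv (z := s) hQ0 hQ1 hc1 hX₁ hX₁' n₁
  have e4 := phi21_lower_inv (c := c) (z := z / Q) hQ0.ne' hX₂ n₂
  rw [mul_div_cancel₀ z hQ0.ne'] at e4
  rw [← hN₁] at e1 e3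
  rw [← hN₂] at e2 e4
  rw [← e1, ← e2, ← e3, ← e4]
  field_simp

/-- Two-site self-duality of nested `₂φ₁` products under the (rescaled) two-site generator. -/
lemma phi21_two_site {c Q s : ℝ} (hQ0 : 0 < Q) (hQ1 : Q < 1) (hc0 : 0 < c)
    (hc1 : c < 1) (x₁ x₂ n₁ n₂ : ℕ) {X₁ X₂ N₁ N₂ : ℝ} (hX₁ : X₁ = Q ^ x₁) (hX₂ : X₂ = Q ^ x₂)
    (hN₁ : N₁ = Q ^ n₁) (hN₂ : N₂ = Q ^ n₂) {z : ℝ} (hz : z = s / (X₁ * N₁ * c)) :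
    (1 - X₁) * (1 - c * X₂) / X₂ *
        (phi21 (X₁ / Q)⁻¹ N₁⁻¹ c Q s * phi21 (Q * X₂)⁻¹ N₂⁻¹ c Q (Q * z)
          - phi21 X₁⁻¹ N₁⁻¹ c Q s * phi21 X₂⁻¹ N₂⁻¹ c Q z)
      + Q / c * ((1 - X₂) * (1 - c * X₁)) / X₂ *
        (phi21 (Q * X₁)⁻¹ N₁⁻¹ c Q s * phi21 (X₂ / Q)⁻¹ N₂⁻¹ c Q (z / Q)
          - phi21 X₁⁻¹ N₁⁻¹ c Q s * phi21 X₂⁻¹ N₂⁻¹ c Q z)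
    = (1 - N₁) * (1 - c * N₂) / N₂ *
        (phi21 X₁⁻¹ (N₁ / Q)⁻¹ c Q s * phi21 X₂⁻¹ (Q * N₂)⁻¹ c Q (Q * z)
          - phi21 X₁⁻¹ N₁⁻¹ c Q s * phi21 X₂⁻¹ N₂⁻¹ c Q z)
      + Q / c * ((1 - N₂) * (1 - c * N₁)) / N₂ *
        (phi21 X₁⁻¹ (Q * N₁)⁻¹ c Q s * phi21 X₂⁻¹ (N₂ / Q)⁻¹ c Q (z / Q)
          - phi21 X₁⁻¹ N₁⁻¹ c Q s * phi21 X₂⁻¹ N₂⁻¹ c Q z) := by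
  have hne : ∀ k : ℕ, Q ^ k ≠ 0 := fun k => pow_ne_zero _ hQ0.ne'
  have hne1 : ∀ k : ℕ, Q * Q ^ k ≠ 1 := fun k => by
    rw [← pow_succ']; exact (pow_lt_one₀ hQ0.le hQ1 (Nat.succ_ne_zero k)).ne
  have hinv : ∀ k : ℕ, (Q ^ k)⁻¹ = Q ^ (-(k : ℤ)) := fun k => by rw [zpow_neg, zpow_natCast]
  have hQ := hQ0.ne'
  have eX := phi21_two_site_aux (X₁ := X₁) (X₂ := X₂) (s := s) (z := z) hQ0 hQ1 hc0 hc1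
    (hX₁ ▸ hne _) (hX₂ ▸ hne _) (hX₁ ▸ hne1 _) (hX₂ ▸ hne1 _) n₁ n₂ (hN₁ ▸ hinv _) (hN₂ ▸ hinv _)
  -- The same formula with x and n exchanged. The relation between `s` and `z` is symmetric in X₁
  -- and N₁, so both applications use the same arguments and, after swapping upper parameters, the
  -- same four series values.
  have eN := phi21_two_site_aux (X₁ := N₁) (X₂ := N₂) (s := s) (z := z) hQ0 hQ1 hc0 hc1
    (hN₁ ▸ hne _) (hN₂ ▸ hne _) (hN₁ ▸ hne1 _) (hN₂ ▸ hne1 _) x₁ x₂ (hX₁ ▸ hinv _) (hX₂ ▸ hinv _)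
  simp only [phi21_comm N₁⁻¹ X₁⁻¹, phi21_comm N₂⁻¹ X₂⁻¹, phi21_comm _ X₁⁻¹, phi21_comm _ X₂⁻¹] at eN
  have h1 : X₁ ≠ 0 := hX₁ ▸ hne _
  have h2 : X₂ ≠ 0 := hX₂ ▸ hne _
  have h3 : N₁ ≠ 0 := hN₁ ▸ hne _
  have h4 : N₂ ≠ 0 := hN₂ ▸ hne _
  have hs : s = z * (X₁ * N₁ * c) := by rw [hz]; field_simp
  clear hX₁ hX₂ hN₁ hN₂ hz
  generalize phi21 X₁⁻¹ N₁⁻¹ c Q s = U at *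
  generalize phi21 X₁⁻¹ N₁⁻¹ c Q (Q * s) = UQ at *
  generalize phi21 X₂⁻¹ N₂⁻¹ c Q z = V at *
  generalize phi21 X₂⁻¹ N₂⁻¹ c Q (z / Q) = W at *
  generalize phi21 (X₁ / Q)⁻¹ N₁⁻¹ c Q s * phi21 (Q * X₂)⁻¹ N₂⁻¹ c Q (Q * z) = a₁ at *
  generalize phi21 (Q * X₁)⁻¹ N₁⁻¹ c Q s * phi21 (X₂ / Q)⁻¹ N₂⁻¹ c Q (z / Q) = a₂ at *
  generalize phi21 X₁⁻¹ (N₁ / Q)⁻¹ c Q s * phi21 X₂⁻¹ (Q * N₂)⁻¹ c Q (Q * z) = a₃ at *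
  generalize phi21 X₁⁻¹ (Q * N₁)⁻¹ c Q s * phi21 X₂⁻¹ (N₂ / Q)⁻¹ c Q (z / Q) = a₄ at *
  subst hs
  have l : ∀ {A B D E P Y : ℝ}, A / Y * (B - E) + P / Y * (D - E)
      = (A * B + P * D) / Y - (A + P) / Y * E := by intros; ring
  -- Only a rational identity in the four series values `U`, `UQ`, `V`, `W` remains, with `s`
  -- eliminated in favour of `z`.
  rw [l, l, eX, eN]
  field_simp
  ring

/-! ### Self-duality of the generator -/

section

variable {L : ℕ}

lemma move_apply_add {x : Config L} {i j : Fin L} (hij : i ≠ j) (hx : 0 < x i) (m : Fin L) :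
    move x i j m + (if m = i then 1 else 0) = x m + (if m = j then 1 else 0) := by
  unfold move
  by_cases h1 : m = j
  · subst h1; simp [hij.symm]
  · by_cases h2 : m = i
    · subst h2; simp [h1]; omega
    · simp [h1, h2]

lemma sum_move_add {x : Config L} {i j : Fin L} (hij : i ≠ j) (hx : 0 < x i)
    (s : Finset (Fin L)) :
    ∑ m ∈ s, move x i j m + (if i ∈ s then 1 else 0) = ∑ m ∈ s, x m + (if j ∈ s then 1 else 0) := by
  have := Finset.sum_congr (rfl : s = s) fun m _ => move_apply_add hij hx m
  simpa [Finset.sum_add_distrib] using this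

lemma mass_move {x : Config L} {i j : Fin L} (hij : i ≠ j) (hx : 0 < x i) :
    mass (move x i j) = mass x := by
  simpa [mass] using sum_move_add hij hx Finset.univ

lemma massLeft_move_add {x : Config L} {i j : Fin L} (hij : i ≠ j) (hx : 0 < x i) (k : Fin L) :
    massLeft (move x i j) k + (if i < k then 1 else 0)
      = massLeft x k + (if j < k then 1 else 0) := by
  simpa [massLeft] using sum_move_add hij hx (Finset.univ.filter (fun m => m < k))

lemma massRight_move_add {x : Config L} {i j : Fin L} (hij : i ≠ j) (hx : 0 < x i) (k : Fin L) :
    massRight (move x i j) k + (if k < i then 1 else 0)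
      = massRight x k + (if k < j then 1 else 0) := by
  simpa [massRight] using sum_move_add hij hx (Finset.univ.filter (fun m => k < m))

lemma massLeft_succ {x : Config L} {i j : Fin L} (hij : i.val + 1 = j.val) :
    massLeft x j = massLeft x i + x i := by
  have : Finset.univ.filter (fun m => m < j) = insert i (Finset.univ.filter (fun m => m < i)) := by
    ext m; simp only [Finset.mem_filter, Finset.mem_univ, true_and, Finset.mem_insert,
      Fin.lt_def, Fin.ext_iff]; omega
  rw [massLeft, this, Finset.sum_insert (by simp), massLeft, add_comm]

lemma massRight_succ {x : Config L} {i j : Fin L} (hij : i.val + 1 = j.val) :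
    massRight x i = x j + massRight x j := by
  have : Finset.univ.filter (fun m => i < m) = insert j (Finset.univ.filter (fun m => j < m)) := by
    ext m; simp only [Finset.mem_filter, Finset.mem_univ, true_and, Finset.mem_insert,
      Fin.lt_def, Fin.ext_iff]; omega
  rw [massRight, this, Finset.sum_insert (by simp), massRight]

end

section

variable {L : ℕ} {q θ α : ℝ}

/-- The argument of the `₂φ₁` at a site, in terms of particle numbers of `x` on the left
(strictly) and of `n` on the right (including the site). -/
noncomputable def siteArg (q θ α : ℝ) (i a b : ℕ) : ℝ :=
  -((q ^ 2) ^ (b + 1) / (α * (q ^ 2) ^ a * q ^ (θ * (2 * i + 1) + 1)))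

/-- One factor of the duality function, in terms of particle numbers. -/
noncomputable def siteFactor (q θ α : ℝ) (i x n a b : ℕ) : ℝ :=
  phi21 ((q ^ 2) ^ x)⁻¹ ((q ^ 2) ^ n)⁻¹ (q ^ (2 * θ)) (q ^ 2) (siteArg q θ α i a b)

lemma dualityFn_eq (hq : 0 < q) (x n : Config L) :
    dualityFn q θ α x n
      = ∏ i : Fin L, siteFactor q θ α i.val (x i) (n i) (massLeft x i) (n i + massRight n i) := by
  refine Finset.prod_congr rfl fun i _ => ?_
  rw [qMeixner, siteFactor, siteArg, cParam]
  have e1 : q ^ (-2 * (x i : ℤ)) = ((q ^ 2) ^ x i)⁻¹ := by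
    rw [← pow_mul, ← zpow_natCast, ← zpow_neg]; push_cast; congr 1
  have e2 : (q ^ 2) ^ (-(n i : ℤ)) = ((q ^ 2) ^ n i)⁻¹ := by rw [zpow_neg, zpow_natCast]
  have e3 : q ^ (2 * (θ - 1)) * q ^ 2 = q ^ (2 * θ) := by
    rw [← Real.rpow_natCast, ← Real.rpow_add hq]; push_cast; congr 1; ring
  have e4 : q ^ (2 * ((massLeft x i : ℝ) - (massRight n i : ℝ)) + θ * (2 * (i.val : ℝ) + 1) + 1)
      = (q ^ 2) ^ massLeft x i / (q ^ 2) ^ massRight n i * q ^ (θ * (2 * (i.val : ℝ) + 1) + 1) := by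
    rw [← pow_mul, ← pow_mul, ← Real.rpow_natCast, ← Real.rpow_natCast, ← Real.rpow_sub hq,
      ← Real.rpow_add hq]
    push_cast; congr 1; ring
  rw [e1, e2, e3, e4]
  congr 2
  have := (pow_pos hq 2).ne'
  have := (Real.rpow_pos_of_pos hq (θ * (2 * (i.val : ℝ) + 1) + 1)).ne'
  rcases eq_or_ne α 0 with rfl | hα
  · simp
  field_simp
  ring

/-- In terms of Q and c the rates are rational in Q^a and Q^b. Both jump directions share the
prefactor q/(1 - q²)², which scales out of the duality relation. -/
lemma bondRate_right (hq : 0 < q) (hq1 : q < 1) (a b : ℕ) :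
    q ^ (2 * θ - 1) * curlyNum (q ^ (2 : ℤ)) a * curlyNum (q ^ (-2 : ℤ)) (θ + b)
      = q / (1 - q ^ 2) ^ 2 *
        ((1 - (q ^ 2) ^ a) * (1 - q ^ (2 * θ) * (q ^ 2) ^ b) / (q ^ 2) ^ b) := by
  have h1 : 1 - q ^ 2 ≠ 0 := by nlinarith
  have hp : ∀ t : ℝ, q ^ t ≠ 0 := fun t => (Real.rpow_pos_of_pos hq t).ne'
  have hq' := hq.ne'
  have e1 : (q ^ (2 : ℤ)) ^ (a : ℝ) = (q ^ 2) ^ a := by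
    rw [Real.rpow_natCast]; rfl
  have e2 : (q ^ (-2 : ℤ)) ^ (θ + b) = (q ^ (2 * θ) * (q ^ 2) ^ b)⁻¹ := by
    rw [← pow_mul, ← Real.rpow_natCast, ← Real.rpow_add hq, ← Real.rpow_neg hq.le,
      ← Real.rpow_intCast, ← Real.rpow_mul hq.le]
    push_cast; congr 1; ring
  have e3 : q ^ (2 * θ - 1) = q ^ (2 * θ) / q := by rw [Real.rpow_sub_one hq.ne']
  have e4 : q ^ (-2 : ℤ) = (q ^ 2)⁻¹ := by rw [zpow_neg]; rfl
  have e5 : q ^ (2 : ℤ) = q ^ 2 := rfl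
  rw [curlyNum, curlyNum, e1, e2, e3, e4, e5]
  have h2 : 1 - (q ^ 2)⁻¹ ≠ 0 := by
    rw [sub_ne_zero]; intro h; apply h1; rw [inv_eq_one.1 h.symm]; ring
  have h3 : 1 - (q ^ 2)⁻¹ = -(1 - q ^ 2) / q ^ 2 := by field_simp; ring
  have := hp (2 * θ)
  rw [h3]
  generalize (q ^ 2) ^ a = A
  have hB : (q ^ 2) ^ b ≠ 0 := by positivity
  generalize (q ^ 2) ^ b = B at *
  generalize q ^ (2 * θ) = c at *
  rw [show 1 - (c * B)⁻¹ = -(1 - c * B) / (c * B) by field_simp; ring]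
  field_simp

lemma bondRate_left (hq : 0 < q) (hq1 : q < 1) (a b : ℕ) :
    q ^ (-2 * θ + 1) * curlyNum (q ^ (-2 : ℤ)) b * curlyNum (q ^ (2 : ℤ)) (θ + a)
      = q / (1 - q ^ 2) ^ 2 * (q ^ 2 / q ^ (2 * θ) *
        ((1 - (q ^ 2) ^ b) * (1 - q ^ (2 * θ) * (q ^ 2) ^ a)) / (q ^ 2) ^ b) := by
  have h1 : 1 - q ^ 2 ≠ 0 := by nlinarith
  have hp : ∀ t : ℝ, q ^ t ≠ 0 := fun t => (Real.rpow_pos_of_pos hq t).ne'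
  have hq' := hq.ne'
  have e5 : q ^ (2 : ℤ) = q ^ 2 := rfl
  have e4 : q ^ (-2 : ℤ) = (q ^ 2)⁻¹ := by rw [zpow_neg]; rfl
  have e1 : (q ^ (2 : ℤ)) ^ (θ + a) = q ^ (2 * θ) * (q ^ 2) ^ a := by
    rw [e5, Real.rpow_add (by positivity), Real.rpow_natCast, Real.rpow_mul hq.le]
    norm_cast
  have e2 : (q ^ (-2 : ℤ)) ^ (b : ℝ) = ((q ^ 2) ^ b)⁻¹ := by
    rw [e4, Real.rpow_natCast, inv_pow]
  have e3 : q ^ (-2 * θ + 1) = q / q ^ (2 * θ) := by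
    rw [Real.rpow_add_one hq', neg_mul, Real.rpow_neg hq.le]; ring
  rw [curlyNum, curlyNum, e1, e2, e3, e4, e5]
  have h3 : 1 - (q ^ 2)⁻¹ = -(1 - q ^ 2) / q ^ 2 := by field_simp; ring
  have := hp (2 * θ)
  rw [h3]
  generalize (q ^ 2) ^ a = A
  have hB : (q ^ 2) ^ b ≠ 0 := by positivity
  generalize (q ^ 2) ^ b = B at *
  generalize q ^ (2 * θ) = c at *
  rw [show 1 - B⁻¹ = -(1 - B) / B by field_simp; ring]
  field_simp

lemma siteArg_succ_left (hq : 0 < q) (i a b : ℕ) :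
    siteArg q θ α i (a + 1) b = siteArg q θ α i a b / q ^ 2 := by
  rw [siteArg, siteArg, pow_succ (q ^ 2) a]
  field_simp

lemma siteArg_succ_right (i a b : ℕ) :
    siteArg q θ α i a (b + 1) = q ^ 2 * siteArg q θ α i a b := by
  rw [siteArg, siteArg, pow_succ (q ^ 2) (b + 1)]
  ring

/-- Two neighbouring factors of the duality function. -/
noncomputable def bondFactor (q θ α : ℝ) (i x₁ n₁ x₂ n₂ a b : ℕ) : ℝ :=
  siteFactor q θ α i x₁ n₁ a (n₁ + (n₂ + b)) * siteFactor q θ α (i + 1) x₂ n₂ (a + x₁) (n₂ + b)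

/-- This is the coupling z = s/(X₁N₁c) required by `phi21_two_site`: passing to the next site adds
x₁ on the left, drops n₁ on the right, and gains c = q^{2θ} from the position. -/
lemma siteArg_bond (hq : 0 < q) (i x₁ n₁ n₂ a b : ℕ) :
    siteArg q θ α (i + 1) (a + x₁) (n₂ + b)
      = siteArg q θ α i a (n₁ + (n₂ + b)) / ((q ^ 2) ^ x₁ * (q ^ 2) ^ n₁ * q ^ (2 * θ)) := by
  have e : q ^ (θ * (2 * ((i + 1 : ℕ) : ℝ) + 1) + 1)
      = q ^ (θ * (2 * (i : ℝ) + 1) + 1) * q ^ (2 * θ) := by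
    rw [← Real.rpow_add hq]; push_cast; congr 1; ring
  rw [siteArg, siteArg, e]
  have h1 := (Real.rpow_pos_of_pos hq (θ * (2 * (i : ℝ) + 1) + 1)).ne'
  have h2 := (Real.rpow_pos_of_pos hq (2 * θ)).ne'
  generalize q ^ (θ * (2 * (i : ℝ) + 1) + 1) = A at *
  generalize q ^ (2 * θ) = c at *
  rcases eq_or_ne α 0 with rfl | hα
  · simp
  field_simp
  ring

lemma bondFactor_duality (hq : 0 < q) (hq1 : q < 1) (hθ : 0 < θ) (i x₁ n₁ x₂ n₂ a b : ℕ) :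
    (1 - (q ^ 2) ^ x₁) * (1 - q ^ (2 * θ) * (q ^ 2) ^ x₂) / (q ^ 2) ^ x₂ *
        (bondFactor q θ α i (x₁ - 1) n₁ (x₂ + 1) n₂ a b - bondFactor q θ α i x₁ n₁ x₂ n₂ a b)
      + q ^ 2 / q ^ (2 * θ) * ((1 - (q ^ 2) ^ x₂) * (1 - q ^ (2 * θ) * (q ^ 2) ^ x₁))
          / (q ^ 2) ^ x₂ *
        (bondFactor q θ α i (x₁ + 1) n₁ (x₂ - 1) n₂ a b - bondFactor q θ α i x₁ n₁ x₂ n₂ a b)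
    = (1 - (q ^ 2) ^ n₁) * (1 - q ^ (2 * θ) * (q ^ 2) ^ n₂) / (q ^ 2) ^ n₂ *
        (bondFactor q θ α i x₁ (n₁ - 1) x₂ (n₂ + 1) a b - bondFactor q θ α i x₁ n₁ x₂ n₂ a b)
      + q ^ 2 / q ^ (2 * θ) * ((1 - (q ^ 2) ^ n₂) * (1 - q ^ (2 * θ) * (q ^ 2) ^ n₁))
          / (q ^ 2) ^ n₂ *
        (bondFactor q θ α i x₁ (n₁ + 1) x₂ (n₂ - 1) a b - bondFactor q θ α i x₁ n₁ x₂ n₂ a b) := by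
  have hQ0 : 0 < q ^ 2 := by positivity
  have hQ1 : q ^ 2 < 1 := by nlinarith
  have key := phi21_two_site (s := siteArg q θ α i a (n₁ + (n₂ + b))) hQ0 hQ1
    (Real.rpow_pos_of_pos hq (2 * θ)) (Real.rpow_lt_one hq.le hq1 (by positivity))
    x₁ x₂ n₁ n₂ rfl rfl rfl rfl (siteArg_bond (α := α) hq i x₁ n₁ n₂ a b)
  have hpred : ∀ k : ℕ, k ≠ 0 → (q ^ 2) ^ (k - 1) = (q ^ 2) ^ k / q ^ 2 := fun k hk => by
    obtain ⟨m, rfl⟩ := Nat.exists_eq_succ_of_ne_zero hk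
    rw [Nat.succ_eq_add_one, Nat.add_sub_cancel, pow_succ _ m, mul_div_cancel_right₀ _ hQ0.ne']
  -- Truncated subtraction at an empty site is harmless, because the rate carries the factor 1 - Q^0
  -- = 0.
  have hcongr : ∀ {k : ℕ} {u v w t : ℝ}, (k ≠ 0 → u = v) →
      (1 - (q ^ 2) ^ k) * t * (u - w) = (1 - (q ^ 2) ^ k) * t * (v - w) := by
    intro k u v w t h
    rcases eq_or_ne k 0 with rfl | hk
    · simp
    · rw [h hk]
  -- In all four moves the argument at the left site is unchanged, while the one at the right site
  -- is multiplied or divided by Q.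
  have g1 : x₁ ≠ 0 → bondFactor q θ α i (x₁ - 1) n₁ (x₂ + 1) n₂ a b
      = phi21 ((q ^ 2) ^ x₁ / q ^ 2)⁻¹ ((q ^ 2) ^ n₁)⁻¹ (q ^ (2 * θ)) (q ^ 2)
          (siteArg q θ α i a (n₁ + (n₂ + b)))
        * phi21 (q ^ 2 * (q ^ 2) ^ x₂)⁻¹ ((q ^ 2) ^ n₂)⁻¹ (q ^ (2 * θ)) (q ^ 2)
          (q ^ 2 * siteArg q θ α (i + 1) (a + x₁) (n₂ + b)) := fun h => by
    have e : q ^ 2 * siteArg q θ α (i + 1) (a + x₁) (n₂ + b)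
        = siteArg q θ α (i + 1) (a + (x₁ - 1)) (n₂ + b) := by
      rw [show a + x₁ = a + (x₁ - 1) + 1 by omega, siteArg_succ_left hq]; field_simp
    rw [bondFactor, siteFactor, siteFactor, hpred _ h, pow_succ' (q ^ 2) x₂, e]
  have g2 : x₂ ≠ 0 → bondFactor q θ α i (x₁ + 1) n₁ (x₂ - 1) n₂ a b
      = phi21 (q ^ 2 * (q ^ 2) ^ x₁)⁻¹ ((q ^ 2) ^ n₁)⁻¹ (q ^ (2 * θ)) (q ^ 2)
          (siteArg q θ α i a (n₁ + (n₂ + b)))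
        * phi21 ((q ^ 2) ^ x₂ / q ^ 2)⁻¹ ((q ^ 2) ^ n₂)⁻¹ (q ^ (2 * θ)) (q ^ 2)
          (siteArg q θ α (i + 1) (a + x₁) (n₂ + b) / q ^ 2) := fun h => by
    rw [bondFactor, siteFactor, siteFactor, hpred _ h, pow_succ' (q ^ 2) x₁, ← add_assoc a x₁ 1,
      siteArg_succ_left hq]
  have g3 : n₁ ≠ 0 → bondFactor q θ α i x₁ (n₁ - 1) x₂ (n₂ + 1) a b
      = phi21 ((q ^ 2) ^ x₁)⁻¹ ((q ^ 2) ^ n₁ / q ^ 2)⁻¹ (q ^ (2 * θ)) (q ^ 2)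
          (siteArg q θ α i a (n₁ + (n₂ + b)))
        * phi21 ((q ^ 2) ^ x₂)⁻¹ (q ^ 2 * (q ^ 2) ^ n₂)⁻¹ (q ^ (2 * θ)) (q ^ 2)
          (q ^ 2 * siteArg q θ α (i + 1) (a + x₁) (n₂ + b)) := fun h => by
    rw [bondFactor, siteFactor, siteFactor, hpred _ h, pow_succ' (q ^ 2) n₂, ← siteArg_succ_right,
      show n₁ - 1 + (n₂ + 1 + b) = n₁ + (n₂ + b) by omega,
      show n₂ + 1 + b = n₂ + b + 1 by omega]
  have g4 : n₂ ≠ 0 → bondFactor q θ α i x₁ (n₁ + 1) x₂ (n₂ - 1) a b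
      = phi21 ((q ^ 2) ^ x₁)⁻¹ (q ^ 2 * (q ^ 2) ^ n₁)⁻¹ (q ^ (2 * θ)) (q ^ 2)
          (siteArg q θ α i a (n₁ + (n₂ + b)))
        * phi21 ((q ^ 2) ^ x₂)⁻¹ ((q ^ 2) ^ n₂ / q ^ 2)⁻¹ (q ^ (2 * θ)) (q ^ 2)
          (siteArg q θ α (i + 1) (a + x₁) (n₂ + b) / q ^ 2) := fun h => by
    have e : siteArg q θ α (i + 1) (a + x₁) (n₂ + b) / q ^ 2
        = siteArg q θ α (i + 1) (a + x₁) (n₂ - 1 + b) := by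
      rw [show n₂ + b = n₂ - 1 + b + 1 by omega, siteArg_succ_right]; field_simp
    rw [bondFactor, siteFactor, siteFactor, hpred _ h, pow_succ' (q ^ 2) n₁, e,
      show n₁ + 1 + (n₂ - 1 + b) = n₁ + (n₂ + b) by omega]
  have g0 : bondFactor q θ α i x₁ n₁ x₂ n₂ a b
      = phi21 ((q ^ 2) ^ x₁)⁻¹ ((q ^ 2) ^ n₁)⁻¹ (q ^ (2 * θ)) (q ^ 2)
          (siteArg q θ α i a (n₁ + (n₂ + b)))
        * phi21 ((q ^ 2) ^ x₂)⁻¹ ((q ^ 2) ^ n₂)⁻¹ (q ^ (2 * θ)) (q ^ 2)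
          (siteArg q θ α (i + 1) (a + x₁) (n₂ + b)) := rfl
  rw [← g0] at key
  have f1 : ∀ {A B C D : ℝ}, A * B / C * D = A * (B / C) * D := by intros; ring
  have f2 : ∀ {E A B C D : ℝ}, E * (A * B) / C * D = A * (E * B / C) * D := by intros; ring
  rw [f1, f2, f1, f2] at key ⊢
  rw [hcongr g1, hcongr g2, hcongr g3, hcongr g4]
  exact key

/-- The factors of the duality function at the sites other than `i` and `j`. -/
noncomputable def offBond (q θ α : ℝ) (i j : Fin L) (x n : Config L) : ℝ :=
  ∏ k ∈ (Finset.univ.erase i).erase j,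
    siteFactor q θ α k (x k) (n k) (massLeft x k) (n k + massRight n k)

lemma dualityFn_eq_bondFactor (hq : 0 < q) {i j : Fin L} (hij : i.val + 1 = j.val)
    (x n : Config L) :
    dualityFn q θ α x n = offBond q θ α i j x n
      * bondFactor q θ α i (x i) (n i) (x j) (n j) (massLeft x i) (massRight n j) := by
  have hne : j ≠ i := by rintro rfl; omega
  rw [dualityFn_eq hq, ← Finset.mul_prod_erase _ _ (Finset.mem_univ i),
    ← Finset.mul_prod_erase _ _ (Finset.mem_erase.2 ⟨hne, Finset.mem_univ j⟩), bondFactor, offBond,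
    massRight_succ hij, massLeft_succ hij, hij]
  ring

/-- A jump across the bond crosses only the cut between `i` and `j`, and that cut defines the left
count at `j` alone. -/
lemma massLeft_move_of_neighbour {i j k : Fin L} (hij : i.val + 1 = j.val) (hk : k ≠ j)
    (x : Config L) :
    (0 < x i → massLeft (move x i j) k = massLeft x k) ∧
    (0 < x j → massLeft (move x j i) k = massLeft x k) := by
  have hne : i ≠ j := by rintro rfl; omega
  have h : i < k ↔ j < k := by
    simp only [Fin.lt_def, ne_eq, Fin.ext_iff] at *; omega
  constructor <;> intro hx
  · simpa [h] using massLeft_move_add hne hx k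
  · simpa [h] using massLeft_move_add hne.symm hx k

lemma massRight_move_of_neighbour {i j k : Fin L} (hij : i.val + 1 = j.val) (hk : k ≠ i)
    (x : Config L) :
    (0 < x i → massRight (move x i j) k = massRight x k) ∧
    (0 < x j → massRight (move x j i) k = massRight x k) := by
  have hne : i ≠ j := by rintro rfl; omega
  have h : k < i ↔ k < j := by
    simp only [Fin.lt_def, ne_eq, Fin.ext_iff] at *; omega
  constructor <;> intro hx
  · simpa [h] using massRight_move_add hne hx k
  · simpa [h] using massRight_move_add hne.symm hx k

lemma move_apply_of_ne {i j k : Fin L} (x : Config L) (hi : k ≠ i) (hj : k ≠ j) :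
    move x i j k = x k := by
  simp [move, hi, hj]

lemma move_apply_left {i j : Fin L} (x : Config L) (hij : i ≠ j) : move x i j i = x i - 1 := by
  simp [move, hij]

lemma move_apply_right {i j : Fin L} (x : Config L) : move x i j j = x j + 1 := by
  simp [move]

lemma offBond_move_left {i j : Fin L} (hij : i.val + 1 = j.val) (x n : Config L) :
    (0 < x i → offBond q θ α i j (move x i j) n = offBond q θ α i j x n) ∧
    (0 < x j → offBond q θ α i j (move x j i) n = offBond q θ α i j x n) := by
  constructor <;> intro hx <;> refine Finset.prod_congr rfl fun k hk => ?_ <;>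
    simp only [Finset.mem_erase, Finset.mem_univ, and_true] at hk
  · rw [move_apply_of_ne x hk.2 hk.1, (massLeft_move_of_neighbour hij hk.1 x).1 hx]
  · rw [move_apply_of_ne x hk.1 hk.2, (massLeft_move_of_neighbour hij hk.1 x).2 hx]

lemma offBond_move_right {i j : Fin L} (hij : i.val + 1 = j.val) (x n : Config L) :
    (0 < n i → offBond q θ α i j x (move n i j) = offBond q θ α i j x n) ∧
    (0 < n j → offBond q θ α i j x (move n j i) = offBond q θ α i j x n) := by
  constructor <;> intro hx <;> refine Finset.prod_congr rfl fun k hk => ?_ <;>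
    simp only [Finset.mem_erase, Finset.mem_univ, and_true] at hk
  · rw [move_apply_of_ne n hk.2 hk.1, (massRight_move_of_neighbour hij hk.2 n).1 hx]
  · rw [move_apply_of_ne n hk.1 hk.2, (massRight_move_of_neighbour hij hk.2 n).2 hx]

/-- All configurations with a nonzero rate share the same factors off the bond, so these come out as
the constant `R` and the two-factor identity remains. -/
lemma bondGenerator_duality (hq : 0 < q) (hq1 : q < 1) (hθ : 0 < θ) {i j : Fin L}
    (hij : i.val + 1 = j.val) (x n : Config L) :
    bondGenerator q θ i j (fun y => dualityFn q θ α y n) x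
      = bondGenerator q θ i j (fun m => dualityFn q θ α x m) n := by
  have hne : i ≠ j := by rintro rfl; omega
  have hcongr : ∀ {k : ℕ} {u v w t : ℝ}, (0 < k → u = v) →
      (1 - (q ^ 2) ^ k) * t * (u - w) = (1 - (q ^ 2) ^ k) * t * (v - w) := by
    intro k u v w t h
    rcases Nat.eq_zero_or_pos k with rfl | hk
    · simp
    · rw [h hk]
  set R := offBond q θ α i j x n with hR
  set a := massLeft x i with ha
  set b := massRight n j with hb
  have d0 : dualityFn q θ α x n = R * bondFactor q θ α i (x i) (n i) (x j) (n j) a b :=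
    dualityFn_eq_bondFactor hq hij x n
  have d1 : 0 < x i → dualityFn q θ α (move x i j) n
      = R * bondFactor q θ α i (x i - 1) (n i) (x j + 1) (n j) a b := fun h => by
    rw [dualityFn_eq_bondFactor hq hij, (offBond_move_left hij x n).1 h, move_apply_left x hne,
      move_apply_right, (massLeft_move_of_neighbour hij hne x).1 h]
  have d2 : 0 < x j → dualityFn q θ α (move x j i) n
      = R * bondFactor q θ α i (x i + 1) (n i) (x j - 1) (n j) a b := fun h => by
    rw [dualityFn_eq_bondFactor hq hij, (offBond_move_left hij x n).2 h, move_apply_left x hne.symm,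
      move_apply_right, (massLeft_move_of_neighbour hij hne x).2 h]
  have d3 : 0 < n i → dualityFn q θ α x (move n i j)
      = R * bondFactor q θ α i (x i) (n i - 1) (x j) (n j + 1) a b := fun h => by
    rw [dualityFn_eq_bondFactor hq hij, (offBond_move_right hij x n).1 h, move_apply_left n hne,
      move_apply_right, (massRight_move_of_neighbour hij hne.symm n).1 h]
  have d4 : 0 < n j → dualityFn q θ α x (move n j i)
      = R * bondFactor q θ α i (x i) (n i + 1) (x j) (n j - 1) a b := fun h => by
    rw [dualityFn_eq_bondFactor hq hij, (offBond_move_right hij x n).2 h,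
      move_apply_left n hne.symm, move_apply_right, (massRight_move_of_neighbour hij hne.symm n).2 h]
  have key := bondFactor_duality (α := α) hq hq1 hθ i (x i) (n i) (x j) (n j) a b
  rw [bondGenerator, bondGenerator, bondRate_right hq hq1, bondRate_left hq hq1,
    bondRate_right hq hq1, bondRate_left hq hq1]
  have f1 : ∀ {G A B C D : ℝ}, G * (A * B / C) * D = A * (G * (B / C)) * D := by intros; ring
  have f2 : ∀ {G E A B C D : ℝ}, G * (E * (A * B) / C) * D = A * (G * (E * B / C)) * D := by
    intros; ring
  rw [f1, f2, f1, f2]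
  rw [hcongr d1, hcongr d2, hcongr d3, hcongr d4, d0]
  linear_combination (q / (1 - q ^ 2) ^ 2 * R) * key

lemma generator_duality (hq : 0 < q) (hq1 : q < 1) (hθ : 0 < θ) (x n : Config L) :
    generator q θ (fun y => dualityFn q θ α y n) x
      = generator q θ (fun m => dualityFn q θ α x m) n := by
  refine Finset.sum_congr rfl fun i _ => ?_
  split_ifs with h
  · exact bondGenerator_duality hq hq1 hθ (by rfl) x n
  · rfl

end

/-! ### Exponentials of rate matrices -/

section

open NormedSpace Matrix
open scoped Matrix Matrix.Norms.Operator Nat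

variable {m n : Type*} [Fintype m] [DecidableEq m] [Fintype n] [DecidableEq n]

lemma hasSum_matrix_exp (A : Matrix m m ℝ) :
    HasSum (fun k : ℕ => ((k ! : ℝ)⁻¹) • A ^ k) (exp A) :=
  exp_series_hasSum_exp' (𝕂 := ℝ) A

/-- The relation passes to powers and then through the exponential series. `D` may be rectangular,
as duality pairs mass classes of different sizes. -/
lemma exp_mul_eq_mul_exp {A : Matrix m m ℝ} {B : Matrix n n ℝ} {D : Matrix m n ℝ}
    (h : A * D = D * B) : exp A * D = D * exp B := by
  have hk : ∀ k : ℕ, A ^ k * D = D * B ^ k := fun k => by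
    induction k with
    | zero => simp
    | succ k ih => rw [pow_succ, Matrix.mul_assoc, h, ← Matrix.mul_assoc, ih, Matrix.mul_assoc,
        ← pow_succ]
  have hA := (hasSum_matrix_exp A).map (Matrix.addMonoidHomMulRight D)
    (continuous_id.matrix_mul continuous_const)
  have hB := (hasSum_matrix_exp B).map (Matrix.addMonoidHomMulLeft D)
    (continuous_const.matrix_mul continuous_id)
  have e : (⇑D.addMonoidHomMulRight ∘ fun k : ℕ => ((k ! : ℝ)⁻¹) • A ^ k)
      = (⇑D.addMonoidHomMulLeft ∘ fun k : ℕ => ((k ! : ℝ)⁻¹) • B ^ k) := by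
    funext k
    change (((k ! : ℝ)⁻¹) • A ^ k) * D = D * (((k ! : ℝ)⁻¹) • B ^ k)
    rw [Matrix.smul_mul, Matrix.mul_smul, hk]
  rw [e] at hA
  exact hA.unique hB

lemma exp_entry_nonneg_of_nonneg {A : Matrix m m ℝ} (h : ∀ i j, 0 ≤ A i j) (i j : m) :
    0 ≤ exp A i j := by
  have hk : ∀ (k : ℕ) i j, 0 ≤ (A ^ k) i j := fun k => by
    induction k with
    | zero => intro i j; rw [pow_zero, Matrix.one_apply]; split_ifs <;> norm_num
    | succ k ih =>
      intro i j
      rw [pow_succ, Matrix.mul_apply]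
      exact Finset.sum_nonneg fun l _ => mul_nonneg (ih _ _) (h _ _)
  have hs := Pi.hasSum.1 (Pi.hasSum.1 (hasSum_matrix_exp A) i) j
  exact hs.nonneg fun k => mul_nonneg (by positivity) (hk k i j)

/-- For large c the matrix A + cI is entrywise nonnegative, and exp A = e^{-c} exp(A + cI) because
scalar matrices commute with A. -/
lemma exp_entry_nonneg {A : Matrix m m ℝ} (h : ∀ i j, i ≠ j → 0 ≤ A i j) (i j : m) :
    0 ≤ exp A i j := by
  obtain ⟨c, hc⟩ : ∃ c : ℝ, ∀ i, 0 ≤ A i i + c := by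
    refine ⟨∑ i, |A i i|, fun i => ?_⟩
    have := Finset.single_le_sum (fun j _ => abs_nonneg (A j j)) (Finset.mem_univ i)
    have := neg_abs_le (A i i)
    linarith
  have e : A = (A + c • (1 : Matrix m m ℝ)) + (-c) • (1 : Matrix m m ℝ) := by
    rw [add_assoc, ← add_smul]; simp
  have hcomm : Commute (A + c • (1 : Matrix m m ℝ)) ((-c) • (1 : Matrix m m ℝ)) :=
    (Commute.one_right _).smul_right _
  have e2 : exp ((-c) • (1 : Matrix m m ℝ)) = Real.exp (-c) • (1 : Matrix m m ℝ) := by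
    have : (-c) • (1 : Matrix m m ℝ) = diagonal fun _ => -c := by
      rw [smul_one_eq_diagonal]
    rw [this, Matrix.exp_diagonal, smul_one_eq_diagonal]
    congr 1
    ext i
    rw [Pi.coe_exp, Real.exp_eq_exp_ℝ]
  rw [e, Matrix.exp_add_of_commute _ _ hcomm, e2, Matrix.mul_smul, Matrix.mul_one,
    Matrix.smul_apply, smul_eq_mul]
  refine mul_nonneg (Real.exp_pos _).le (exp_entry_nonneg_of_nonneg (fun i j => ?_) i j)
  rcases eq_or_ne i j with rfl | hij
  · simpa using hc i
  · simpa [hij] using h i j hij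

/-- Zero row sums mean that A kills the all-ones column, so A intertwines with the zero matrix. -/
lemma exp_row_sum {A : Matrix m m ℝ} (h : ∀ i, ∑ j, A i j = 0) (i : m) :
    ∑ j, exp A i j = 1 := by
  have := exp_mul_eq_mul_exp (A := A) (B := (0 : Matrix Unit Unit ℝ)) (D := Matrix.of fun _ _ => 1)
    (by ext i j; simp [Matrix.mul_apply, h])
  have := congrFun (congrFun this i) ()
  simpa [Matrix.mul_apply, exp_zero] using this

/-- The norm is the ℓ^∞ operator norm, the largest absolute row sum. -/
lemma norm_le_one_of_substochastic {R : Matrix m m ℝ} (h0 : ∀ i j, 0 ≤ R i j)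
    (h1 : ∀ i, ∑ j, R i j ≤ 1) : ‖R‖ ≤ 1 := by
  rw [Matrix.linfty_opNorm_def]
  have : (Finset.univ.sup fun i => ∑ j, ‖R i j‖₊) ≤ (1 : ℝ≥0) := by
    refine Finset.sup_le fun i _ => ?_
    rw [← NNReal.coe_le_coe]
    push_cast
    simpa [abs_of_nonneg (h0 _ _)] using h1 i
  exact_mod_cast this

lemma norm_pow_sub_pow_le {𝔸 : Type*} [NormedRing 𝔸] {R S : 𝔸} (hR : ‖R‖ ≤ 1) (hS : ‖S‖ ≤ 1)
    (k : ℕ) : ‖R ^ k - S ^ k‖ ≤ k * ‖R - S‖ := by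
  induction k with
  | zero => simp
  | succ k ih =>
    have hSk : ‖(R - S) * S ^ k‖ ≤ ‖R - S‖ := by
      -- The norm of the unit need not be at most 1 in a general normed ring, so S^0 is treated
      -- apart.
      rcases Nat.eq_zero_or_pos k with rfl | hk
      · simp
      · refine (norm_mul_le _ _).trans (mul_le_of_le_one_right (norm_nonneg _) ?_)
        exact (norm_pow_le' S hk).trans (pow_le_one₀ (norm_nonneg _) hS)
    have e : R ^ (k + 1) - S ^ (k + 1) = R * (R ^ k - S ^ k) + (R - S) * S ^ k := by
      rw [pow_succ', pow_succ']; noncomm_ring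
    rw [e]
    refine (norm_add_le _ _).trans ?_
    have h1 : ‖R * (R ^ k - S ^ k)‖ ≤ k * ‖R - S‖ :=
      (norm_mul_le _ _).trans ((mul_le_of_le_one_left (norm_nonneg _) hR).trans ih)
    push_cast
    linarith

lemma tendsto_exp_sub_one_div (A : Matrix m m ℝ) :
    Tendsto (fun h : ℝ => h⁻¹ • (exp (h • A) - 1)) (𝓝[≠] 0) (𝓝 A) := by
  have := (hasDerivAt_exp_smul_const (𝕂 := ℝ) A 0).tendsto_slope_zero
  simp only [zero_add, zero_smul, exp_zero, one_mul] at this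
  exact this

lemma tendsto_coe_nhdsNE_zero : Tendsto (fun h : ℝ≥0 => (h : ℝ)) (𝓝[≠] 0) (𝓝[≠] 0) := by
  refine tendsto_nhdsWithin_iff.2 ⟨?_, ?_⟩
  · exact (NNReal.continuous_coe.tendsto' 0 0 rfl).mono_left nhdsWithin_le_nhds
  · filter_upwards [self_mem_nhdsWithin] with h hh0
    exact NNReal.coe_ne_zero.2 hh0

/-- Chernoff-type product formula for substochastic matrices. -/
lemma tendsto_pow_exp {A : Matrix m m ℝ} (hA0 : ∀ i j, i ≠ j → 0 ≤ A i j)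
    (hA1 : ∀ i, ∑ j, A i j = 0) {R : ℝ≥0 → Matrix m m ℝ} (hR0 : ∀ t i j, 0 ≤ R t i j)
    (hR1 : ∀ t i, ∑ j, R t i j ≤ 1)
    (hR : ∀ i j, Tendsto (fun h : ℝ≥0 => (R h i j - (1 : Matrix m m ℝ) i j) / (h : ℝ)) (𝓝[≠] 0)
      (𝓝 (A i j))) {t : ℝ≥0} (ht : 0 < t) :
    Tendsto (fun k : ℕ => R (t / (k + 1 : ℕ)) ^ (k + 1)) atTop (𝓝 (exp ((t : ℝ) • A))) := by
  have hh : Tendsto (fun k : ℕ => t / ((k + 1 : ℕ) : ℝ≥0)) atTop (𝓝[≠] 0) := by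
    refine tendsto_nhdsWithin_iff.2 ⟨?_, Eventually.of_forall fun k => ?_⟩
    · have := ((tendsto_const_div_atTop_nhds_zero_nat (t : ℝ)).comp (tendsto_add_atTop_nat 1))
      rw [← NNReal.tendsto_coe]
      simpa [Function.comp_def] using this
    · exact (div_pos ht (by positivity)).ne'
  have l1 : Tendsto (fun h : ℝ≥0 => ((h : ℝ)⁻¹) • (R h - 1)) (𝓝[≠] 0) (𝓝 A) := by
    refine tendsto_pi_nhds.2 fun i => tendsto_pi_nhds.2 fun j => ?_
    refine (hR i j).congr fun h => ?_
    rw [Matrix.smul_apply, Matrix.sub_apply, smul_eq_mul]; ring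
  have l2 := ((l1.sub ((tendsto_exp_sub_one_div A).comp tendsto_coe_nhdsNE_zero)).comp hh).norm.const_mul (t : ℝ)
  simp only [sub_self, norm_zero, mul_zero] at l2
  refine tendsto_iff_norm_sub_tendsto_zero.2 ?_
  refine squeeze_zero (fun k => norm_nonneg _) (fun k => ?_) l2
  have hs : ∀ s : ℝ≥0, ‖exp ((s : ℝ) • A)‖ ≤ 1 := fun s =>
    norm_le_one_of_substochastic
      (exp_entry_nonneg fun i j hij => mul_nonneg s.2 (hA0 i j hij))
      fun i => (exp_row_sum (fun i => by
        simp only [Matrix.smul_apply, smul_eq_mul, ← Finset.mul_sum, hA1, mul_zero]) i).le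
  set h : ℝ≥0 := t / ((k + 1 : ℕ) : ℝ≥0) with hdef
  have hkt : ((k + 1 : ℕ) : ℝ) * (h : ℝ) = t := by
    rw [hdef]; push_cast; field_simp
  have hpos : (h : ℝ) ≠ 0 := NNReal.coe_ne_zero.2 (div_pos ht (by positivity)).ne'
  have e1 : exp ((t : ℝ) • A) = exp ((h : ℝ) • A) ^ (k + 1) := by
    rw [← Matrix.exp_nsmul, ← hkt, mul_smul, ← Nat.cast_smul_eq_nsmul ℝ]
  rw [e1]
  -- With h = t/(k+1) the telescoping bound is (k+1)‖R_h - exp(hA)‖, that is, t times the distance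
  -- between the two difference quotients at h; both tend to A. `R` need not be a semigroup.
  refine (norm_pow_sub_pow_le (norm_le_one_of_substochastic (hR0 h) (hR1 h)) (hs h) _).trans
    (le_of_eq ?_)
  have e2 : R h - exp ((h : ℝ) • A)
      = (h : ℝ) • (((h : ℝ)⁻¹ • (R h - 1)) - ((h : ℝ)⁻¹ • (exp ((h : ℝ) • A) - 1))) := by
    rw [← smul_sub, smul_inv_smul₀ hpos]; abel
  rw [e2, norm_smul, Real.norm_of_nonneg (NNReal.coe_nonneg h), ← mul_assoc, hkt]
  rfl

end

/-! ### Markov semigroups on countable unions of finite invariant classes -/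

lemma integral_single {E : Type*} [DecidableEq E] [MeasurableSpace E] [MeasurableSingletonClass E]
    (μ : Measure E) (z : E) : ∫ y, (Pi.single z 1 : E → ℝ) y ∂μ = μ.real {z} := by
  rw [← integral_indicator_one (measurableSet_singleton z)]
  refine integral_congr_ae (Eventually.of_forall fun y => ?_)
  by_cases hy : y = z <;> simp [Set.indicator, hy]

lemma integrable_single {E : Type*} [DecidableEq E] [MeasurableSpace E]
    [DiscreteMeasurableSpace E] (μ : Measure E) [IsFiniteMeasure μ] (z : E) :
    Integrable (Pi.single z 1 : E → ℝ) μ := by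
  refine Integrable.of_bound (Measurable.of_discrete).aestronglyMeasurable 1
    (Eventually.of_forall fun y => ?_)
  by_cases hy : y = z <;> simp [hy]

section FiberMarkov

open NormedSpace
open scoped Matrix ENNReal

variable {E ι : Type*} [DecidableEq E]

/-- `𝓛` is a linear operator with the positivity and conservativity of a Markov generator, acting
separately on each fibre of `m`. -/
structure IsFiberGenerator (𝓛 : (E → ℝ) → E → ℝ) (m : E → ι) : Prop where
  add : ∀ f g x, 𝓛 (fun y => f y + g y) x = 𝓛 f x + 𝓛 g x
  smul : ∀ (c : ℝ) f x, 𝓛 (fun y => c * f y) x = c * 𝓛 f x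
  congr : ∀ f g x, (∀ y, m y = m x → f y = g y) → 𝓛 f x = 𝓛 g x
  one : ∀ x, 𝓛 (fun _ => 1) x = 0
  nonneg : ∀ x y, x ≠ y → 0 ≤ 𝓛 (Pi.single y 1) x

variable {𝓛 : (E → ℝ) → E → ℝ} {m : E → ι}

/-- The rate matrix of `𝓛` on a fibre of `m`. -/
def fiberMatrix (𝓛 : (E → ℝ) → E → ℝ) (m : E → ι) (i : ι) :
    Matrix {x // m x = i} {x // m x = i} ℝ :=
  Matrix.of fun x y => 𝓛 (Pi.single y.1 1) x

lemma IsFiberGenerator.off_diag (h : IsFiberGenerator 𝓛 m) (i : ι) (x y : {x // m x = i})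
    (hxy : x ≠ y) : 0 ≤ fiberMatrix 𝓛 m i x y :=
  h.nonneg _ _ fun e => hxy (Subtype.ext e)

variable [∀ i, Fintype {x // m x = i}]

/-- Locality on the fibre allows f to be replaced by a finite combination of point indicators there;
linearity does the rest. -/
lemma IsFiberGenerator.eq_sum (h : IsFiberGenerator 𝓛 m) {i : ι} (f : E → ℝ)
    (x : {x // m x = i}) : 𝓛 f x = ∑ y, fiberMatrix 𝓛 m i x y * f y := by
  have hsum : ∀ s : Finset {x // m x = i},
      𝓛 (fun z => ∑ y ∈ s, f y * (Pi.single y.1 1 : E → ℝ) z) x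
        = ∑ y ∈ s, fiberMatrix 𝓛 m i x y * f y := fun s => by
    induction s using Finset.induction_on with
    | empty => simpa using h.smul 0 (fun _ => 1) x
    | insert a s ha ih =>
      simp only [Finset.sum_insert ha]
      rw [h.add, ih, h.smul, fiberMatrix, Matrix.of_apply, mul_comm]
  rw [← hsum]
  refine h.congr _ _ _ fun y hy => ?_
  have hy' : m y = i := hy.trans x.2
  rw [Finset.sum_eq_single ⟨y, hy'⟩]
  · simp
  · intro b _ hb
    rw [Pi.single_eq_of_ne, mul_zero]
    rintro rfl
    exact hb rfl
  · simp

lemma IsFiberGenerator.row_sum (h : IsFiberGenerator 𝓛 m) (i : ι) (x : {x // m x = i}) :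
    ∑ y, fiberMatrix 𝓛 m i x y = 0 := by
  have := h.eq_sum (fun _ => 1) x
  rw [h.one] at this
  simpa using this.symm

/-- The transition matrix at time `t` on a fibre of `m`. -/
noncomputable def fiberTransition (𝓛 : (E → ℝ) → E → ℝ) (m : E → ι)
    [∀ i, Fintype {x // m x = i}] (t : ℝ≥0) (i : ι) :
    Matrix {x // m x = i} {x // m x = i} ℝ :=
  exp ((t : ℝ) • fiberMatrix 𝓛 m i)

lemma IsFiberGenerator.transition_nonneg (h : IsFiberGenerator 𝓛 m) (t : ℝ≥0) (i : ι)
    (x y : {x // m x = i}) : 0 ≤ fiberTransition 𝓛 m t i x y :=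
  exp_entry_nonneg (fun x y hxy => mul_nonneg t.2 (h.off_diag i x y hxy)) x y

lemma IsFiberGenerator.transition_row_sum (h : IsFiberGenerator 𝓛 m) (t : ℝ≥0) (i : ι)
    (x : {x // m x = i}) : ∑ y, fiberTransition 𝓛 m t i x y = 1 :=
  exp_row_sum (fun x => by
    simp only [Matrix.smul_apply, smul_eq_mul, ← Finset.mul_sum, h.row_sum, mul_zero]) x

lemma fiberTransition_zero (i : ι) : fiberTransition 𝓛 m 0 i = 1 := by
  rw [fiberTransition, NNReal.coe_zero, zero_smul, exp_zero]

lemma fiberTransition_add (s t : ℝ≥0) (i : ι) :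
    fiberTransition 𝓛 m (s + t) i = fiberTransition 𝓛 m s i * fiberTransition 𝓛 m t i := by
  rw [fiberTransition, NNReal.coe_add, add_smul, Matrix.exp_add_of_commute]
  · rfl
  · exact ((Commute.refl _).smul_left _).smul_right _

variable [MeasurableSpace E] [Countable E] [MeasurableSingletonClass E]

/-- The Markov kernel with fibrewise transition matrices `exp (t A)`. -/
noncomputable def fiberKernel (𝓛 : (E → ℝ) → E → ℝ) (m : E → ι)
    [∀ i, Fintype {x // m x = i}] (t : ℝ≥0) : Kernel E E :=
  Kernel.ofFunOfCountable fun x => ∑ y : {y // m y = m x},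
    ENNReal.ofReal (fiberTransition 𝓛 m t (m x) ⟨x, rfl⟩ y) • Measure.dirac y.1

lemma fiberKernel_apply (t : ℝ≥0) {i : ι} (x : {x // m x = i}) :
    fiberKernel 𝓛 m t x = ∑ y : {y // m y = i},
      ENNReal.ofReal (fiberTransition 𝓛 m t i x y) • Measure.dirac y.1 := by
  obtain ⟨x, rfl⟩ := x
  rfl

/-- The law is a finite sum of point masses, so no growth condition on `f`, and hence on the duality
function, is needed. -/
lemma integrable_fiberKernel (t : ℝ≥0) (x : E) (f : E → ℝ) :
    Integrable f (fiberKernel 𝓛 m t x) := by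
  rw [fiberKernel_apply t (⟨x, rfl⟩ : {y // m y = m x})]
  refine integrable_finsetSum_measure.2 fun y _ => ?_
  exact (integrable_dirac (by simp)).smul_measure ENNReal.ofReal_ne_top

lemma IsFiberGenerator.integral_kernel (h : IsFiberGenerator 𝓛 m) (t : ℝ≥0) {i : ι}
    (x : {x // m x = i}) (f : E → ℝ) :
    ∫ y, f y ∂(fiberKernel 𝓛 m t x) = ∑ y, fiberTransition 𝓛 m t i x y * f y := by
  rw [fiberKernel_apply, integral_finsetSum_measure]
  · refine Finset.sum_congr rfl fun y _ => ?_
    rw [integral_smul_measure, integral_dirac, ENNReal.toReal_ofReal (h.transition_nonneg _ _ _ _),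
      smul_eq_mul]
  · intro y _
    exact (integrable_dirac (by simp)).smul_measure ENNReal.ofReal_ne_top

lemma IsFiberGenerator.isMarkovKernel (h : IsFiberGenerator 𝓛 m) (t : ℝ≥0) :
    IsMarkovKernel (fiberKernel 𝓛 m t) := by
  refine ⟨fun x => ⟨?_⟩⟩
  rw [fiberKernel_apply t (⟨x, rfl⟩ : {y // m y = m x})]
  simp only [Measure.coe_finsetSum, Finset.sum_apply, Measure.smul_apply, measure_univ,
    smul_eq_mul, mul_one]
  rw [← ENNReal.ofReal_sum_of_nonneg fun y _ => h.transition_nonneg _ _ _ _,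
    h.transition_row_sum, ENNReal.ofReal_one]

lemma measure_ext_of_integral {μ ν : Measure E} [IsFiniteMeasure μ] [IsFiniteMeasure ν]
    (h : ∀ z, ∫ y, (Pi.single z 1 : E → ℝ) y ∂μ = ∫ y, (Pi.single z 1 : E → ℝ) y ∂ν) :
    μ = ν := by
  refine Measure.ext_of_singleton fun z => ?_
  have := h z
  rwa [integral_single, integral_single, measureReal_eq_measureReal_iff] at this

/-- The fibrewise exponentials form a transition semigroup with generator `𝓛`. -/
lemma IsFiberGenerator.isTransitionSemigroup (h : IsFiberGenerator 𝓛 m) :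
    IsTransitionSemigroup 𝓛 (fiberKernel 𝓛 m) where
  markov := h.isMarkovKernel
  zero := by
    have := h.isMarkovKernel 0
    ext1 x
    refine measure_ext_of_integral fun z => ?_
    rw [Kernel.id_apply, integral_dirac, h.integral_kernel 0 (⟨x, rfl⟩ : {y // m y = m x}),
      fiberTransition_zero, Finset.sum_eq_single ⟨x, rfl⟩]
    · simp
    · intro b _ hb; rw [Matrix.one_apply_ne' hb, zero_mul]
    · simp
  add s t := by
    have := h.isMarkovKernel s
    have := h.isMarkovKernel t
    have := h.isMarkovKernel (s + t)
    ext1 x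
    refine measure_ext_of_integral fun z => ?_
    have hint : Integrable (Pi.single z 1 : E → ℝ)
        ((fiberKernel 𝓛 m t ∘ₖ fiberKernel 𝓛 m s) x) := by
      exact integrable_single _ z
    rw [Kernel.integral_comp hint, h.integral_kernel (s + t) (⟨x, rfl⟩ : {y // m y = m x}),
      h.integral_kernel s (⟨x, rfl⟩ : {y // m y = m x}), fiberTransition_add]
    simp only [h.integral_kernel t, Matrix.mul_apply, Finset.mul_sum, Finset.sum_mul]
    rw [Finset.sum_comm]
    simp only [mul_assoc]
  generator f _ x := by
    have hx : m x = m x := rfl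
    have key := tendsto_finsetSum (Finset.univ : Finset {y // m y = m x}) fun y _ =>
      (((tendsto_pi_nhds.1 (tendsto_pi_nhds.1 (tendsto_exp_sub_one_div
        (fiberMatrix 𝓛 m (m x))) ⟨x, rfl⟩) y).comp tendsto_coe_nhdsNE_zero).mul_const (f y))
    rw [h.eq_sum f (⟨x, rfl⟩ : {y // m y = m x})]
    refine key.congr fun t => ?_
    rw [h.integral_kernel t (⟨x, rfl⟩ : {y // m y = m x})]
    have e1 : f x = ∑ y, (1 : Matrix {y // m y = m x} {y // m y = m x} ℝ) ⟨x, rfl⟩ y * f y := by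
      rw [Finset.sum_eq_single ⟨x, rfl⟩]
      · simp
      · intro b _ hb; rw [Matrix.one_apply_ne' hb, zero_mul]
      · simp
    conv_rhs => rw [e1]
    rw [← Finset.sum_sub_distrib, Finset.sum_div]
    refine Finset.sum_congr rfl fun y _ => ?_
    simp only [Function.comp_apply, Matrix.smul_apply, Matrix.sub_apply, smul_eq_mul,
      fiberTransition]
    ring

/-- The generator determines the transition semigroup. -/
lemma IsFiberGenerator.eq_fiberKernel (h : IsFiberGenerator 𝓛 m) {κ : ℝ≥0 → Kernel E E}
    (hκ : IsTransitionSemigroup 𝓛 κ) : κ = fiberKernel 𝓛 m := by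
  have hM := hκ.markov
  have hM' := h.isMarkovKernel
  -- `κ` is not known to preserve the fibres, so its compression to a fibre is a priori only
  -- substochastic.
  let R : (i : ι) → ℝ≥0 → Matrix {x // m x = i} {x // m x = i} ℝ :=
    fun i t => Matrix.of fun x y => (κ t x).real {y.1}
  have hR0 : ∀ i t x y, 0 ≤ R i t x y := fun i t x y => measureReal_nonneg
  have hR1 : ∀ i t x, ∑ y, R i t x y ≤ 1 := fun i t x => by
    have : ∑ y : {y // m y = i}, (κ t x).real {y.1}
        = (κ t x).real (((Finset.univ : Finset {y // m y = i}).map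
            (Function.Embedding.subtype _) : Finset E) : Set E) := by
      rw [← sum_measureReal_singleton, Finset.sum_map]; rfl
    exact this.le.trans measureReal_le_one
  have hlim : ∀ i x y, Tendsto (fun t : ℝ≥0 => (R i t x y - (1 : Matrix _ _ ℝ) x y) / (t : ℝ))
      (𝓝[≠] 0) (𝓝 (fiberMatrix 𝓛 m i x y)) := fun i x y => by
    have := hκ.generator (Pi.single y.1 1)
      ((Set.finite_singleton y.1).subset (by simp)) x.1
    refine this.congr fun t => ?_
    rw [integral_single]
    congr 2
    by_cases hxy : x = y
    · subst hxy; simp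
    · rw [Matrix.one_apply_ne hxy, Pi.single_eq_of_ne]
      exact fun e => hxy (Subtype.ext e)
  -- Chapman–Kolmogorov with only the intermediate states in the fibre kept: the discarded terms are
  -- nonnegative, hence an inequality.
  have hsuper : ∀ i s t x z, (R i s * R i t) x z ≤ R i (s + t) x z := fun i s t x z => by
    have e1 : R i (s + t) x z = ∫ y, (κ t y).real {z.1} ∂(κ s x) := by
      change (κ (s + t) x).real {z.1} = _
      rw [← integral_single, hκ.add, Kernel.integral_comp]
      · simp only [integral_single]
      · rw [← hκ.add]; exact integrable_single _ _
    have e2 : (R i s * R i t) x z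
        = ∫ y, ∑ w : {w // m w = i}, (Pi.single w.1 1 : E → ℝ) y * (κ t w).real {z.1}
            ∂(κ s x) := by
      rw [integral_finsetSum _ fun w _ => (integrable_single _ _).mul_const _]
      simp only [integral_mul_const, integral_single]
      rfl
    rw [e1, e2]
    refine integral_mono (integrable_finsetSum _ fun w _ => (integrable_single _ _).mul_const _)
      (Integrable.of_bound (Measurable.of_discrete).aestronglyMeasurable 1
        (Eventually.of_forall fun y => ?_)) fun y => ?_
    · rw [Real.norm_of_nonneg measureReal_nonneg]; exact measureReal_le_one
    · by_cases hy : m y = i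
      · refine le_of_eq ?_
        rw [Finset.sum_eq_single ⟨y, hy⟩]
        · simp
        · intro b _ hb
          rw [Pi.single_eq_of_ne, zero_mul]
          rintro rfl
          exact hb rfl
        · simp
      · refine (Finset.sum_nonpos fun w _ => ?_).trans measureReal_nonneg
        rw [Pi.single_eq_of_ne, zero_mul]
        rintro rfl
        exact hy w.2
  have hpow : ∀ i s (k : ℕ) x z, (R i s ^ (k + 1)) x z ≤ R i (((k + 1 : ℕ) : ℝ≥0) * s) x z := by
    intro i s k
    induction k with
    | zero => intro x z; simp
    | succ k ih =>
      intro x z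
      rw [pow_succ]
      refine le_trans ?_ ((hsuper i (((k + 1 : ℕ) : ℝ≥0) * s) s x z).trans (le_of_eq ?_))
      · rw [Matrix.mul_apply, Matrix.mul_apply]
        exact Finset.sum_le_sum fun y _ => mul_le_mul_of_nonneg_right (ih _ _) (hR0 _ _ _ _)
      · congr 1; push_cast; ring
  -- Supermultiplicativity bounds R_{t/(k+1)}^{k+1} by R_t, and the left side tends to the
  -- exponential.
  have hle : ∀ i t, 0 < t → ∀ x y, fiberTransition 𝓛 m t i x y ≤ R i t x y := by
    intro i t ht x y
    have := tendsto_pow_exp (h.off_diag i) (h.row_sum i) (hR0 i) (hR1 i) (hlim i) ht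
    refine le_of_tendsto (tendsto_pi_nhds.1 (tendsto_pi_nhds.1 this x) y)
      (Eventually.of_forall fun k => (hpow i _ k x y).trans (le_of_eq ?_))
    congr 1
    field_simp
  funext t
  rcases eq_or_ne t 0 with rfl | ht
  · rw [hκ.zero, h.isTransitionSemigroup.zero]
  ext1 x
  -- A probability measure dominated by another one equals it; this also rules out escape from the
  -- fibre.
  refine (Measure.eq_of_le_of_isProbabilityMeasure ?_).symm
  rw [fiberKernel_apply t (⟨x, rfl⟩ : {y // m y = m x})]
  refine Measure.le_iff.2 fun B _ => ?_
  classical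
  simp only [Measure.coe_finsetSum, Finset.sum_apply, Measure.smul_apply, smul_eq_mul,
    Measure.dirac_apply]
  calc ∑ y : {y // m y = m x}, ENNReal.ofReal (fiberTransition 𝓛 m t (m x) ⟨x, rfl⟩ y)
          * B.indicator 1 y.1
      ≤ ∑ y : {y // m y = m x}, if y.1 ∈ B then κ t x {y.1} else 0 := by
        refine Finset.sum_le_sum fun y _ => ?_
        by_cases hy : y.1 ∈ B
        · rw [Set.indicator_of_mem hy, if_pos hy, Pi.one_apply, mul_one, ← ofReal_measureReal]
          exact ENNReal.ofReal_le_ofReal (hle _ t (pos_iff_ne_zero.2 ht) _ _)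
        · simp [hy]
    _ = κ t x (((Finset.univ.filter fun y : {y // m y = m x} => y.1 ∈ B).map
          (Function.Embedding.subtype _) : Finset E) : Set E) := by
        rw [← Finset.sum_filter, ← sum_measure_singleton, Finset.sum_map]; rfl
    _ ≤ κ t x B := measure_mono fun y hy => by
        simp only [Finset.coe_map, Function.Embedding.subtype_apply, Set.mem_image,
          Finset.coe_filter, Finset.mem_univ, true_and, Set.mem_ofPred_eq] at hy
        obtain ⟨w, hw, rfl⟩ := hy
        exact hw

/-- Duality of the generators implies duality of the semigroups. -/
lemma IsFiberGenerator.semigroupSelfDual (h : IsFiberGenerator 𝓛 m) {D : E → E → ℝ}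
    (hD : ∀ x n, 𝓛 (fun y => D y n) x = 𝓛 (fun y => D x y) n) :
    SemigroupSelfDual (fiberKernel 𝓛 m) D := by
  refine fun x n t _ => ⟨integrable_fiberKernel t x _, integrable_fiberKernel t n _, ?_⟩
  let Dm : Matrix {y // m y = m x} {y // m y = m n} ℝ := Matrix.of fun y z => D y z
  -- Generator duality, restricted to the classes of `x` and `n`, says that D intertwines the first
  -- rate matrix with the transpose of the second.
  have hc : ((t : ℝ) • fiberMatrix 𝓛 m (m x)) * Dm = Dm * ((t : ℝ) • fiberMatrix 𝓛 m (m n))ᵀ := by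
    ext y z
    have := hD y z
    rw [h.eq_sum _ y, h.eq_sum _ z] at this
    rw [Matrix.smul_mul, Matrix.transpose_smul, Matrix.mul_smul, Matrix.smul_apply,
      Matrix.smul_apply, Matrix.mul_apply, Matrix.mul_apply]
    exact congrArg _ (this.trans (Finset.sum_congr rfl fun _ _ => mul_comm _ _))
  have := congrFun (congrFun (exp_mul_eq_mul_exp hc) ⟨x, rfl⟩) ⟨n, rfl⟩
  rw [Matrix.exp_transpose, Matrix.mul_apply, Matrix.mul_apply] at this
  rw [h.integral_kernel t (⟨x, rfl⟩ : {y // m y = m x}),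
    h.integral_kernel t (⟨n, rfl⟩ : {y // m y = m n})]
  simp only [fiberTransition]
  refine this.trans (Finset.sum_congr rfl fun y _ => ?_)
  rw [Matrix.transpose_apply, mul_comm]
  rfl

end FiberMarkov

/-! ### From the semigroup to processes -/

section

variable {E : Type*} [MeasurableSpace E] [MeasurableSingletonClass E]

/-- The law at time `t` of a Markov process started at `x` is given by the semigroup. -/
lemma IsMarkovProcess.map_eq {Ω : Type*} [MeasurableSpace Ω] {κ : ℝ≥0 → Kernel E E}
    {P : E → Measure Ω} {X : ℝ≥0 → Ω → E} (hX : IsMarkovProcess κ P X) (x : E) (t : ℝ≥0) :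
    (P x).map (X t) = κ t x := by
  have := hX.prob x
  ext B hB
  -- The Markov property at time 0 with trivial past, conditioned on the full-measure event X_0 = x.
  have key := hX.markov x 0 t Set.univ MeasurableSet.univ x B hB
  have hstart : ∀ᵐ ω ∂(P x), ω ∈ X 0 ⁻¹' {x} := hX.start x
  have h1 : P x (X 0 ⁻¹' {x}) = 1 :=
    (prob_compl_eq_zero_iff ((hX.measurable 0) (measurableSet_singleton x))).1 hstart
  rw [Set.univ_inter, zero_add, h1, one_mul, Set.inter_comm,
    measure_inter_conull (show X 0 ⁻¹' {x} ∈ ae (P x) from hstart)] at key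
  rw [Measure.map_apply (hX.measurable t) hB, key]

lemma SemigroupSelfDual.areDual {κ : ℝ≥0 → Kernel E E} {D : E → E → ℝ}
    (h : SemigroupSelfDual κ D) {Ω Ω' : Type*} [MeasurableSpace Ω] [MeasurableSpace Ω']
    {P : E → Measure Ω} {X : ℝ≥0 → Ω → E} {P' : E → Measure Ω'} {X' : ℝ≥0 → Ω' → E}
    (hX : IsMarkovProcess κ P X) (hX' : IsMarkovProcess κ P' X') : AreDual P X P' X' D := by
  intro x n t ht
  obtain ⟨h1, h2, h3⟩ := h x n t ht
  rw [← hX.map_eq] at h1 h3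
  rw [← hX'.map_eq] at h2 h3
  have hm := (hX.measurable t).aemeasurable (μ := P x)
  have hm' := (hX'.measurable t).aemeasurable (μ := P' n)
  refine ⟨h1.comp_aemeasurable hm, h2.comp_aemeasurable hm', ?_⟩
  rwa [integral_map hm h1.1, integral_map hm' h2.1] at h3

end

/-! ### The transition semigroup of ASIP -/

section

variable {L : ℕ}

lemma finite_mass_fiber (N : ℕ) : Finite {x : Config L // mass x = N} := by
  have : ({x : Config L | mass x = N}).Finite := by
    refine (Set.finite_Iic (fun _ : Fin L => N)).subset fun x hx => ?_
    rw [Set.mem_Iic]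
    intro i
    rw [← (show mass x = N from hx)]
    exact Finset.single_le_sum (fun j _ => Nat.zero_le (x j)) (Finset.mem_univ i)
  exact this.to_subtype

noncomputable instance fintypeMassFiber (N : ℕ) : Fintype {x : Config L // mass x = N} :=
  @Fintype.ofFinite _ (finite_mass_fiber N)

variable {q θ : ℝ}

lemma bondRate_right_nonneg (hq : 0 < q) (hq1 : q < 1) (hθ : 0 < θ) (a b : ℕ) :
    0 ≤ q ^ (2 * θ - 1) * curlyNum (q ^ (2 : ℤ)) a * curlyNum (q ^ (-2 : ℤ)) (θ + b) := by
  rw [bondRate_right hq hq1]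
  have h1 : (q ^ 2) ^ a ≤ 1 := pow_le_one₀ (by positivity) (by nlinarith)
  have h2 : (q ^ 2) ^ b ≤ 1 := pow_le_one₀ (by positivity) (by nlinarith)
  have h3 : q ^ (2 * θ) ≤ 1 := Real.rpow_le_one hq.le hq1.le (by positivity)
  have h4 : q ^ (2 * θ) * (q ^ 2) ^ b ≤ 1 := mul_le_one₀ h3 (by positivity) h2
  have := sub_nonneg.2 h1
  have := sub_nonneg.2 h4
  positivity

lemma bondRate_left_nonneg (hq : 0 < q) (hq1 : q < 1) (hθ : 0 < θ) (a b : ℕ) :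
    0 ≤ q ^ (-2 * θ + 1) * curlyNum (q ^ (-2 : ℤ)) b * curlyNum (q ^ (2 : ℤ)) (θ + a) := by
  rw [bondRate_left hq hq1]
  have h1 : (q ^ 2) ^ a ≤ 1 := pow_le_one₀ (by positivity) (by nlinarith)
  have h2 : (q ^ 2) ^ b ≤ 1 := pow_le_one₀ (by positivity) (by nlinarith)
  have h3 : q ^ (2 * θ) ≤ 1 := Real.rpow_le_one hq.le hq1.le (by positivity)
  have h4 : q ^ (2 * θ) * (q ^ 2) ^ a ≤ 1 := mul_le_one₀ h3 (by positivity) h1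
  have := sub_nonneg.2 h2
  have := sub_nonneg.2 h4
  positivity

lemma bondRate_right_zero (b : ℕ) :
    q ^ (2 * θ - 1) * curlyNum (q ^ (2 : ℤ)) (0 : ℕ) * curlyNum (q ^ (-2 : ℤ)) (θ + b) = 0 := by
  simp [curlyNum]

lemma bondRate_left_zero (a : ℕ) :
    q ^ (-2 * θ + 1) * curlyNum (q ^ (-2 : ℤ)) (0 : ℕ) * curlyNum (q ^ (2 : ℤ)) (θ + a) = 0 := by
  simp [curlyNum]

lemma bondGenerator_congr {i j : Fin L} (hij : i ≠ j) {f g : Config L → ℝ} {x : Config L}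
    (h : ∀ y, mass y = mass x → f y = g y) :
    bondGenerator q θ i j f x = bondGenerator q θ i j g x := by
  have hx := h x rfl
  rw [bondGenerator, bondGenerator, hx]
  congr 1
  -- From an empty site `move` would create a particle and leave the mass class; the zero rate
  -- removes that term.
  · rcases Nat.eq_zero_or_pos (x i) with h0 | h0
    · rw [h0, bondRate_right_zero, zero_mul, zero_mul]
    · rw [h _ (mass_move hij h0)]
  · rcases Nat.eq_zero_or_pos (x j) with h0 | h0
    · rw [h0, bondRate_left_zero, zero_mul, zero_mul]
    · rw [h _ (mass_move hij.symm h0)]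

lemma generator_isFiberGenerator (hq : 0 < q) (hq1 : q < 1) (hθ : 0 < θ) :
    IsFiberGenerator (generator (L := L) q θ) mass where
  add f g x := by
    simp only [generator, ← Finset.sum_add_distrib]
    refine Finset.sum_congr rfl fun i _ => ?_
    split_ifs
    · simp only [bondGenerator]; ring
    · ring
  smul c f x := by
    simp only [generator, Finset.mul_sum]
    refine Finset.sum_congr rfl fun i _ => ?_
    split_ifs
    · simp only [bondGenerator]; ring
    · ring
  congr f g x h := by
    refine Finset.sum_congr rfl fun i _ => ?_
    split_ifs
    · exact bondGenerator_congr (by simp [Fin.ext_iff]) h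
    · rfl
  one x := by
    refine Finset.sum_eq_zero fun i _ => ?_
    split_ifs
    · simp [bondGenerator]
    · rfl
  nonneg x y hxy := by
    refine Finset.sum_nonneg fun i _ => ?_
    have hs : ∀ z, 0 ≤ (Pi.single y 1 : Config L → ℝ) z := fun z => by
      by_cases h : z = y <;> simp [h]
    split_ifs
    · rw [bondGenerator, Pi.single_eq_of_ne hxy, sub_zero, sub_zero]
      exact add_nonneg (mul_nonneg (bondRate_right_nonneg hq hq1 hθ _ _) (hs _))
        (mul_nonneg (bondRate_left_nonneg hq hq1 hθ _ _) (hs _))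
    · exact le_rfl

end

/-! ### Infinite q-shifted factorials -/

section

variable {Q : ℝ}

lemma multipliable_qPoch (hQ0 : 0 < Q) (hQ1 : Q < 1) (a : ℝ) :
    Multipliable fun k : ℕ => 1 - a * Q ^ k := by
  have hs : Summable fun k : ℕ => ‖-(a * Q ^ k)‖ :=
    ((summable_geometric_of_lt_one hQ0.le hQ1).mul_left a).neg.norm
  simpa [sub_eq_add_neg] using multipliable_one_add_of_summable hs

lemma qPochInf_succ (hQ0 : 0 < Q) (hQ1 : Q < 1) (a : ℝ) :
    qPochInf a Q = (1 - a) * qPochInf (a * Q) Q := by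
  have e : ∀ k : ℕ, 1 - a * Q ^ (k + 1) = 1 - a * Q * Q ^ k := fun k => by ring
  rw [qPochInf, tprod_eq_zero_mul']
  · simp only [pow_zero, mul_one, e]; rfl
  · simpa only [e] using multipliable_qPoch hQ0 hQ1 (a * Q)

lemma qPochInf_eq_mul (hQ0 : 0 < Q) (hQ1 : Q < 1) (a : ℝ) (n : ℕ) :
    qPochInf a Q = qPoch a Q n * qPochInf (a * Q ^ n) Q := by
  induction n with
  | zero => simp [qPoch_zero]
  | succ n ih => rw [ih, qPoch_succ, qPochInf_succ hQ0 hQ1 (a * Q ^ n), pow_succ]; ring_nf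

lemma tendsto_qPoch (hQ0 : 0 < Q) (hQ1 : Q < 1) (a : ℝ) :
    Tendsto (qPoch a Q) atTop (𝓝 (qPochInf a Q)) :=
  (multipliable_qPoch hQ0 hQ1 a).hasProd.tendsto_prod_nat

lemma one_le_qPoch (hQ0 : 0 < Q) {a : ℝ} (ha : a ≤ 0) (n : ℕ) : 1 ≤ qPoch a Q n := by
  induction n with
  | zero => rw [qPoch_zero]
  | succ n ih =>
    rw [qPoch_succ]
    have : a * Q ^ n ≤ 0 := mul_nonpos_of_nonpos_of_nonneg ha (by positivity)
    nlinarith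

lemma one_le_qPochInf (hQ0 : 0 < Q) (hQ1 : Q < 1) {a : ℝ} (ha : a ≤ 0) : 1 ≤ qPochInf a Q :=
  ge_of_tendsto' (tendsto_qPoch hQ0 hQ1 a) (one_le_qPoch hQ0 ha)

lemma qPochInf_mul_pow_le (hQ0 : 0 < Q) (hQ1 : Q < 1) {a : ℝ} (ha : a ≤ 0) (n : ℕ) :
    qPochInf (a * Q ^ n) Q ≤ qPochInf a Q := by
  rw [qPochInf_eq_mul hQ0 hQ1 a n]
  refine le_mul_of_one_le_left ?_ (one_le_qPoch hQ0 ha n)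
  have : a * Q ^ n ≤ 0 := mul_nonpos_of_nonpos_of_nonneg ha (by positivity)
  linarith [one_le_qPochInf hQ0 hQ1 this]

/-- The tail is (a;Q)_∞/(a;Q)_n, and for a ≤ 0 both products are at least 1. -/
lemma tendsto_qPochInf_mul_pow (hQ0 : 0 < Q) (hQ1 : Q < 1) {a : ℝ} (ha : a ≤ 0) :
    Tendsto (fun n : ℕ => qPochInf (a * Q ^ n) Q) atTop (𝓝 1) := by
  have h1 : qPochInf a Q ≠ 0 := by linarith [one_le_qPochInf hQ0 hQ1 ha]
  have := (tendsto_const_nhds (x := qPochInf a Q)).div (tendsto_qPoch hQ0 hQ1 a) h1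
  rw [div_self h1] at this
  refine this.congr fun n => ?_
  have h2 : qPoch a Q n ≠ 0 := by linarith [one_le_qPoch hQ0 ha n]
  rw [Pi.div_apply, qPochInf_eq_mul hQ0 hQ1 a n, mul_div_cancel_left₀ _ h2]

end

/-! ### Orthogonality of q-Meixner polynomials -/

section

variable {B c Q : ℝ}

/-- The unnormalised q-Meixner weight without the infinite product. -/
noncomputable def meixnerPreweight (B c Q : ℝ) (u : ℕ) : ℝ :=
  qPoch B Q u / qPoch Q Q u * c ^ u * Q ^ (u.choose 2)

/-- The unnormalised q-Meixner weight. -/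
noncomputable def meixnerWeight (B c Q : ℝ) (u : ℕ) : ℝ :=
  meixnerPreweight B c Q u * qPochInf (-(c * B * Q ^ u)) Q

lemma choose_succ_two (u : ℕ) : (u + 1).choose 2 = u + u.choose 2 := by
  rw [Nat.choose_succ_succ' u 1, Nat.choose_one_right]

lemma meixnerPreweight_pos (hQ0 : 0 < Q) (hQ1 : Q < 1) (hB1 : B < 1) (hc : 0 < c) (u : ℕ) :
    0 < meixnerPreweight B c Q u := by
  have := qPoch_pos hQ0 hQ1 hB1 u
  have := qPoch_pos hQ0 hQ1 hQ1 u
  unfold meixnerPreweight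
  positivity

lemma meixnerPreweight_succ (hQ0 : 0 < Q) (hQ1 : Q < 1) (u : ℕ) :
    meixnerPreweight B c Q (u + 1) * (1 - Q ^ (u + 1))
      = meixnerPreweight B c Q u * ((1 - B * Q ^ u) * (c * Q ^ u)) := by
  have h1 := (qPoch_pos hQ0 hQ1 hQ1 u).ne'
  have h2 : 1 - Q * Q ^ u ≠ 0 := by
    have := (qPoch_pos hQ0 hQ1 hQ1 (u + 1)).ne'
    rw [qPoch_succ] at this
    exact right_ne_zero_of_mul this
  rw [meixnerPreweight, meixnerPreweight, qPoch_succ, qPoch_succ, choose_succ_two, pow_succ' Q u,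
    pow_add]
  generalize 1 - Q * Q ^ u = d at *
  field_simp
  ring

lemma summable_meixnerPreweight (hQ0 : 0 < Q) (hQ1 : Q < 1) (hB1 : B < 1) (hc : 0 < c) :
    Summable (meixnerPreweight B c Q) := by
  have hpos := meixnerPreweight_pos hQ0 hQ1 hB1 hc
  refine summable_of_ratio_test_tendsto_lt_one (l := 0) zero_lt_one
    (Eventually.of_forall fun u => (hpos u).ne') ?_
  have hQ := tendsto_pow_atTop_nhds_zero_of_lt_one hQ0.le hQ1
  have hlim : Tendsto (fun u : ℕ => (1 - B * Q ^ u) * (c * Q ^ u) / (1 - Q ^ (u + 1))) atTop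
      (𝓝 ((1 - B * 0) * (c * 0) / (1 - 0))) :=
    ((tendsto_const_nhds.sub (hQ.const_mul B)).mul (hQ.const_mul c)).div
      (tendsto_const_nhds.sub (hQ.comp (tendsto_add_atTop_nat 1))) (by norm_num)
  simp only [mul_zero, zero_div] at hlim
  refine hlim.congr fun u => ?_
  have h1 : 1 - Q ^ (u + 1) ≠ 0 :=
    sub_ne_zero.2 (pow_lt_one₀ hQ0.le hQ1 (Nat.succ_ne_zero u)).ne'
  rw [Real.norm_of_nonneg (hpos _).le, Real.norm_of_nonneg (hpos _).le,
    div_eq_div_iff h1 (hpos u).ne', meixnerPreweight_succ hQ0 hQ1]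
  ring

lemma meixnerWeight_pos (hQ0 : 0 < Q) (hQ1 : Q < 1) (hB0 : 0 < B) (hB1 : B < 1) (hc : 0 < c)
    (u : ℕ) : 0 < meixnerWeight B c Q u := by
  refine mul_pos (meixnerPreweight_pos hQ0 hQ1 hB1 hc u) ?_
  have : -(c * B * Q ^ u) ≤ 0 := by have : 0 < c * B * Q ^ u := by positivity
                                    linarith
  linarith [one_le_qPochInf hQ0 hQ1 this]

lemma meixnerWeight_le (hQ0 : 0 < Q) (hQ1 : Q < 1) (hB0 : 0 < B) (hB1 : B < 1) (hc : 0 < c)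
    (u : ℕ) : meixnerWeight B c Q u ≤ meixnerPreweight B c Q u * qPochInf (-(c * B)) Q := by
  refine mul_le_mul_of_nonneg_left ?_ (meixnerPreweight_pos hQ0 hQ1 hB1 hc u).le
  have : -(c * B) ≤ 0 := by have : 0 < c * B := by positivity
                            linarith
  simpa using qPochInf_mul_pow_le hQ0 hQ1 this u

lemma summable_meixnerWeight (hQ0 : 0 < Q) (hQ1 : Q < 1) (hB0 : 0 < B) (hB1 : B < 1)
    (hc : 0 < c) : Summable (meixnerWeight B c Q) :=
  ((summable_meixnerPreweight hQ0 hQ1 hB1 hc).mul_right _).of_nonneg_of_le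
    (fun u => (meixnerWeight_pos hQ0 hQ1 hB0 hB1 hc u).le) (meixnerWeight_le hQ0 hQ1 hB0 hB1 hc)

/-- The difference of the summands telescopes as h(u) - h(u+1) with h(u) = (1 - Q^u) w(u), which is
zero at u = 0. -/
lemma tsum_meixnerWeight_step (hQ0 : 0 < Q) (hQ1 : Q < 1) (hB0 : 0 < B) (hB1 : B < 1)
    (hc : 0 < c) :
    ∑' u, meixnerWeight B c Q u = (1 + c) * ∑' u, meixnerWeight B (c * Q) Q u := by
  have hs1 := summable_meixnerWeight hQ0 hQ1 hB0 hB1 hc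
  have hs2 := summable_meixnerWeight hQ0 hQ1 hB0 hB1 (mul_pos hc hQ0)
  set h : ℕ → ℝ := fun u => (1 - Q ^ u) * meixnerWeight B c Q u with hdef
  have hh : Summable h := by
    refine hs1.of_nonneg_of_le (fun u => ?_) (fun u => ?_)
    · exact mul_nonneg (sub_nonneg.2 (pow_le_one₀ hQ0.le hQ1.le))
        (meixnerWeight_pos hQ0 hQ1 hB0 hB1 hc u).le
    · refine mul_le_of_le_one_left (meixnerWeight_pos hQ0 hQ1 hB0 hB1 hc u).le ?_
      have : 0 < Q ^ u := by positivity
      linarith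
  have hstep : ∀ u, meixnerWeight B c Q u - (1 + c) * meixnerWeight B (c * Q) Q u
      = h u - h (u + 1) := fun u => by
    have e1 := meixnerPreweight_succ (B := B) (c := c) hQ0 hQ1 u
    have e2 : meixnerPreweight B (c * Q) Q u = meixnerPreweight B c Q u * Q ^ u := by
      rw [meixnerPreweight, meixnerPreweight, mul_pow]; ring
    have e3 := qPochInf_succ hQ0 hQ1 (-(c * B * Q ^ u))
    have e4 : -(c * Q * B * Q ^ u) = -(c * B * Q ^ u) * Q := by ring
    have e5 : -(c * B * Q ^ (u + 1)) = -(c * B * Q ^ u) * Q := by ring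
    simp only [hdef, meixnerWeight]
    rw [e2, e4, e5, e3]
    generalize qPochInf (-(c * B * Q ^ u) * Q) Q = p
    linear_combination p * e1
  have e : ∑' u, (h u - h (u + 1)) = 0 := by
    rw [hh.tsum_sub ((summable_nat_add_iff 1).2 hh), hh.tsum_eq_zero_add]
    simp [hdef]
  rw [← tsum_congr hstep, hs1.tsum_sub (hs2.mul_left _), tsum_mul_left] at e
  linarith

/-- The `₁φ₁` summation: total mass of the q-Meixner weight. -/
lemma hasSum_meixnerWeight (hQ0 : 0 < Q) (hQ1 : Q < 1) (hB0 : 0 < B) (hB1 : B < 1)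
    (hc : 0 < c) : HasSum (meixnerWeight B c Q) (qPochInf (-c) Q) := by
  have hiter : ∀ n : ℕ, ∑' u, meixnerWeight B c Q u
      = qPoch (-c) Q n * ∑' u, meixnerWeight B (c * Q ^ n) Q u := fun n => by
    induction n with
    | zero => simp [qPoch_zero]
    | succ n ih =>
      rw [ih, qPoch_succ, tsum_meixnerWeight_step hQ0 hQ1 hB0 hB1 (by positivity), pow_succ]
      ring_nf
  -- As c tends to 0 only the term u = 0 survives. The preweight at the original c, times the
  -- largest infinite product, dominates.
  have hlim : Tendsto (fun n : ℕ => ∑' u, meixnerWeight B (c * Q ^ n) Q u) atTop (𝓝 1) := by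
    have hw : ∀ n u : ℕ, meixnerWeight B (c * Q ^ n) Q u = meixnerPreweight B c Q u * (Q ^ n) ^ u
        * qPochInf (-(c * B * Q ^ u) * Q ^ n) Q := fun n u => by
      rw [meixnerWeight, meixnerPreweight, meixnerPreweight, mul_pow,
        show -(c * Q ^ n * B * Q ^ u) = -(c * B * Q ^ u) * Q ^ n by ring]
      ring
    have hneg : ∀ u : ℕ, -(c * B * Q ^ u) ≤ 0 := fun u => by
      have : 0 < c * B * Q ^ u := by positivity
      linarith
    have h1 : (1 : ℝ) = ∑' u : ℕ, if u = 0 then 1 else 0 := by simp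
    rw [h1]
    refine tendsto_tsum_of_dominated_convergence
      (bound := fun u => meixnerPreweight B c Q u * qPochInf (-(c * B)) Q)
      ((summable_meixnerPreweight hQ0 hQ1 hB1 hc).mul_right _) (fun u => ?_)
      (Eventually.of_forall fun n u => ?_)
    · have := ((((tendsto_pow_atTop_nhds_zero_of_lt_one hQ0.le hQ1).pow u).const_mul
        (meixnerPreweight B c Q u)).mul (tendsto_qPochInf_mul_pow hQ0 hQ1 (hneg u)))
      simp only [← hw] at this
      refine this.trans (le_of_eq (congrArg 𝓝 ?_))
      rcases Nat.eq_zero_or_pos u with rfl | hu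
      · simp [meixnerPreweight, qPoch_zero]
      · simp [hu.ne']
    · rw [Real.norm_of_nonneg (meixnerWeight_pos hQ0 hQ1 hB0 hB1 (by positivity) u).le, hw]
      have hp := (meixnerPreweight_pos hQ0 hQ1 hB1 hc u).le
      have h1 := qPochInf_mul_pow_le hQ0 hQ1 (hneg u) n
      have h2 := (qPochInf_mul_pow_le hQ0 hQ1 (hneg 0) u)
      have h3 : -(c * B * Q ^ u) = -(c * B * Q ^ 0) * Q ^ u := by ring
      have h4 : -(c * B * Q ^ 0) = -(c * B) := by ring
      rw [← h3, h4] at h2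
      have h5 : (Q ^ n) ^ u ≤ 1 := pow_le_one₀ (by positivity) (pow_le_one₀ hQ0.le hQ1.le)
      have h6 : 0 ≤ qPochInf (-(c * B * Q ^ u) * Q ^ n) Q := by
        have : -(c * B * Q ^ u) * Q ^ n ≤ 0 :=
          mul_nonpos_of_nonpos_of_nonneg (hneg u) (by positivity)
        linarith [one_le_qPochInf hQ0 hQ1 this]
      exact mul_le_mul (mul_le_of_le_one_right hp h5) (h1.trans h2) h6 hp
  have := (tendsto_qPoch hQ0 hQ1 (-c)).mul hlim
  rw [mul_one] at this
  rw [(tendsto_nhds_unique (this.congr fun n => (hiter n).symm) tendsto_const_nhds)]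
  exact (summable_meixnerWeight hQ0 hQ1 hB0 hB1 hc).hasSum

/-- The factor 1 - Q^{-(u+1)} cancels the last factor of (Q;Q)_{u+1}; splitting off the first factor
of (B;Q)_{u+1} leaves the weight with BQ in place of B. -/
lemma meixnerWeight_succ_mul (hQ0 : 0 < Q) (hQ1 : Q < 1) (u : ℕ) :
    meixnerWeight B c Q (u + 1) * (1 - (Q ^ (u + 1))⁻¹)
      = (1 - B) * (-c / Q) * meixnerWeight (B * Q) c Q u := by
  have h1 : 1 - Q * Q ^ u ≠ 0 := by
    have := (qPoch_pos hQ0 hQ1 hQ1 (u + 1)).ne'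
    rw [qPoch_succ] at this
    exact right_ne_zero_of_mul this
  have h2 := (qPoch_pos hQ0 hQ1 hQ1 u).ne'
  have e1 : -(c * B * Q ^ (u + 1)) = -(c * (B * Q) * Q ^ u) := by ring
  have e2 : 1 - (Q ^ (u + 1))⁻¹ = -(1 - Q * Q ^ u) / (Q * Q ^ u) := by
    rw [pow_succ']; field_simp; ring
  rw [meixnerWeight, meixnerWeight, meixnerPreweight, meixnerPreweight, e1, e2, qPoch_succ',
    qPoch_succ Q Q, choose_succ_two, pow_add]
  generalize 1 - Q * Q ^ u = d at *
  field_simp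
  rw [pow_add]
  ring

/-- (Q^{-y};Q)_{k+1} vanishes at y = 0, and after an index shift the sum is the k-th moment for the
parameter BQ. Hence `B` varies in the induction. -/
lemma hasSum_meixnerWeight_mul_qPoch (hQ0 : 0 < Q) (hQ1 : Q < 1) (hc : 0 < c) (k : ℕ) :
    ∀ {B : ℝ}, 0 < B → B < 1 →
    HasSum (fun y => meixnerWeight B c Q y * qPoch (Q ^ y)⁻¹ Q k)
      (qPoch B Q k * (-c / Q) ^ k * qPochInf (-c) Q) := by
  induction k with
  | zero => intro B hB0 hB1; simpa [qPoch_zero] using hasSum_meixnerWeight hQ0 hQ1 hB0 hB1 hc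
  | succ k ih =>
    intro B hB0 hB1
    have h := (ih (B := B * Q) (by positivity) (by nlinarith)).mul_left ((1 - B) * (-c / Q))
    have e0 : qPoch (Q ^ 0)⁻¹ Q (k + 1) = 0 := by rw [qPoch_succ']; simp
    have e1 : ∀ u, (1 - B) * (-c / Q) * (meixnerWeight (B * Q) c Q u * qPoch (Q ^ u)⁻¹ Q k)
        = meixnerWeight B c Q (u + 1) * qPoch (Q ^ (u + 1))⁻¹ Q (k + 1) := fun u => by
      have e1 : (Q ^ (u + 1))⁻¹ * Q = (Q ^ u)⁻¹ := by rw [pow_succ]; field_simp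
      rw [qPoch_succ', e1, ← mul_assoc, ← mul_assoc, meixnerWeight_succ_mul hQ0 hQ1]
    simp only [e1] at h
    have h2 := (hasSum_nat_add_iff (f := fun y => meixnerWeight B c Q y
      * qPoch (Q ^ y)⁻¹ Q (k + 1)) 1).1 h
    rw [Finset.sum_range_one, e0, mul_zero, add_zero] at h2
    rw [qPoch_succ']
    rw [show (1 - B) * qPoch (B * Q) Q k * (-c / Q) ^ (k + 1) * qPochInf (-c) Q
      = (1 - B) * (-c / Q) * (qPoch (B * Q) Q k * (-c / Q) ^ k * qPochInf (-c) Q) by ring]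
    exact h2

end

/-! ### Polynomial expansions, orthogonality and squared norms in one variable -/

section

open Polynomial

variable {B c Q : ℝ}

/-- The q-binomial theorem for a terminating series. -/
lemma sum_qPoch_div_qPoch (hQ0 : 0 < Q) (hQ1 : Q < 1) (n : ℕ) (z : ℝ) :
    ∑ k ∈ Finset.range (n + 1), qPoch (Q ^ n)⁻¹ Q k / qPoch Q Q k * z ^ k
      = qPoch (z * (Q ^ n)⁻¹) Q n := by
  have hvan : ∀ n : ℕ, qPoch (Q ^ n)⁻¹ Q (n + 1) = 0 := fun n => by
    have := qPoch_zpow_neg_eq_zero hQ0.ne' (Nat.lt_succ_self n)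
    rwa [zpow_neg, zpow_natCast] at this
  have hinv : ∀ n : ℕ, (Q ^ (n + 1))⁻¹ * Q = (Q ^ n)⁻¹ := fun n => by rw [pow_succ]; field_simp
  induction n with
  | zero => simp [qPoch_zero]
  | succ n ih =>
    -- The q-Pascal rule; summed against powers of z it multiplies the previous sum by 1 -
    -- zQ^{-(n+1)}.
    have hcoef : ∀ k : ℕ, qPoch (Q ^ (n + 1))⁻¹ Q (k + 1) / qPoch Q Q (k + 1)
        = qPoch (Q ^ n)⁻¹ Q (k + 1) / qPoch Q Q (k + 1)
          - (Q ^ (n + 1))⁻¹ * (qPoch (Q ^ n)⁻¹ Q k / qPoch Q Q k) := fun k => by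
      have h1 := (qPoch_pos hQ0 hQ1 hQ1 k).ne'
      have h2 : 1 - Q * Q ^ k ≠ 0 := by
        have := (qPoch_pos hQ0 hQ1 hQ1 (k + 1)).ne'
        rw [qPoch_succ] at this
        exact right_ne_zero_of_mul this
      have hQn : Q ^ n ≠ 0 := by positivity
      rw [qPoch_succ', hinv, qPoch_succ (Q ^ n)⁻¹, qPoch_succ Q Q]
      rw [div_sub' (mul_ne_zero h1 h2)]
      rw [div_eq_div_iff (mul_ne_zero h1 h2) (mul_ne_zero h1 h2), pow_succ]
      have hQ := hQ0.ne'
      field_simp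
      ring
    rw [Finset.sum_range_succ']
    simp only [hcoef, sub_mul, Finset.sum_sub_distrib]
    have e1 : ∑ k ∈ Finset.range (n + 1), qPoch (Q ^ n)⁻¹ Q (k + 1) / qPoch Q Q (k + 1)
          * z ^ (k + 1) + qPoch (Q ^ (n + 1))⁻¹ Q 0 / qPoch Q Q 0 * z ^ 0
        = ∑ k ∈ Finset.range (n + 1), qPoch (Q ^ n)⁻¹ Q k / qPoch Q Q k * z ^ k := by
      rw [qPoch_zero, ← qPoch_zero (Q ^ n)⁻¹ Q,
        ← Finset.sum_range_succ' (fun k => qPoch (Q ^ n)⁻¹ Q k / qPoch Q Q k * z ^ k) (n + 1),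
        Finset.sum_range_succ _ (n + 1), hvan, zero_div, zero_mul, add_zero]
    have e2 : ∑ k ∈ Finset.range (n + 1), (Q ^ (n + 1))⁻¹ * (qPoch (Q ^ n)⁻¹ Q k / qPoch Q Q k)
          * z ^ (k + 1)
        = z * (Q ^ (n + 1))⁻¹
          * ∑ k ∈ Finset.range (n + 1), qPoch (Q ^ n)⁻¹ Q k / qPoch Q Q k * z ^ k := by
      rw [Finset.mul_sum]
      exact Finset.sum_congr rfl fun k _ => by ring
    rw [sub_add_eq_add_sub, e1, e2, ih, qPoch_succ',
      show z * (Q ^ (n + 1))⁻¹ * Q = z * (Q ^ n)⁻¹ by rw [mul_assoc, hinv]]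
    ring

lemma qPoch_inv_pow_self (hQ0 : 0 < Q) (n : ℕ) :
    qPoch (Q ^ n)⁻¹ Q n * Q ^ ((n + 1).choose 2) = (-1) ^ n * qPoch Q Q n := by
  induction n with
  | zero => simp [qPoch_zero]
  | succ n ih =>
    have hinv : (Q ^ (n + 1))⁻¹ * Q = (Q ^ n)⁻¹ := by rw [pow_succ]; field_simp
    have h1 : (1 - (Q ^ (n + 1))⁻¹) * Q ^ (n + 1) = -(1 - Q * Q ^ n) := by
      rw [sub_mul, inv_mul_cancel₀ (pow_ne_zero _ hQ0.ne')]; ring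
    rw [qPoch_succ', hinv, qPoch_succ Q Q, choose_succ_two (n + 1), pow_add]
    linear_combination (qPoch (Q ^ n)⁻¹ Q n * Q ^ (n + 1).choose 2) * h1
      - (1 - Q * Q ^ n) * ih

/-- The q-Meixner polynomial at the lattice point `Q ^ (-y)`. -/
noncomputable def meixner (B c Q : ℝ) (n y : ℕ) : ℝ :=
  phi21 (Q ^ y)⁻¹ (Q ^ n)⁻¹ B Q (-(Q ^ (n + 1) / c))

lemma meixner_eq_sum (hQ : Q ≠ 0) (n y : ℕ) :
    meixner B c Q n y = ∑ k ∈ Finset.range (n + 1),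
      (qPoch (Q ^ n)⁻¹ Q k / qPoch Q Q k / qPoch B Q k * (-(Q ^ (n + 1) / c)) ^ k)
        * qPoch (Q ^ y)⁻¹ Q k := by
  have := phi21_eq_sum (a := (Q ^ y)⁻¹) (c := B) (z := -(Q ^ (n + 1) / c)) hQ n
  rw [zpow_neg, zpow_natCast] at this
  rw [meixner, this]
  refine Finset.sum_congr rfl fun k _ => ?_
  rw [phiCoeff]; ring

/-- Polynomials which, multiplied with the q-Meixner weight, shift its parameter. -/
noncomputable def shiftPoly (B c Q : ℝ) (j : ℕ) : ℝ[X] :=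
  ∏ i ∈ Finset.range j, (X + C (c * B / Q ^ (i + 1)))

lemma shiftPoly_monic (j : ℕ) : (shiftPoly B c Q j).Monic :=
  monic_prod_of_monic _ _ fun _ _ => monic_X_add_C _

lemma shiftPoly_natDegree (j : ℕ) : (shiftPoly B c Q j).natDegree = j := by
  rw [shiftPoly, natDegree_prod_of_monic _ _ fun _ _ => monic_X_add_C _]
  simp

/-- Each factor Q^{-y} + cB/Q^{i+1} equals Q^{-y}(1 + cBQ^y/Q^{i+1}): the bracket prepends one
factor to the infinite product, and Q^{-y} turns the power of c into one of c/Q. -/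
lemma meixnerWeight_mul_shiftPoly (hQ0 : 0 < Q) (hQ1 : Q < 1) (j y : ℕ) :
    meixnerWeight B c Q y * (shiftPoly B c Q j).eval (Q ^ y)⁻¹
      = meixnerWeight B (c / Q ^ j) Q y := by
  induction j with
  | zero => simp [shiftPoly]
  | succ j ih =>
    rw [shiftPoly, Finset.prod_range_succ, eval_mul, ← shiftPoly, ← mul_assoc, ih]
    have hQ := hQ0.ne'
    have e := qPochInf_succ hQ0 hQ1 (-(c / Q ^ (j + 1) * B * Q ^ y))
    have e1 : -(c / Q ^ (j + 1) * B * Q ^ y) * Q = -(c / Q ^ j * B * Q ^ y) := by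
      rw [pow_succ]; field_simp
    rw [meixnerWeight, meixnerWeight, e, e1, meixnerPreweight, meixnerPreweight]
    simp only [eval_add, eval_X, eval_C, div_pow]
    have h2 : (Q ^ (j + 1)) ^ y = (Q ^ j) ^ y * Q ^ y := by rw [pow_succ, mul_pow]
    have h3 : (Q ^ j) ^ y ≠ 0 := by positivity
    rw [h2]
    generalize (Q ^ j) ^ y = w at *
    generalize qPochInf (-(c / Q ^ j * B * Q ^ y)) Q = p
    generalize qPoch B Q y / qPoch Q Q y = r
    field_simp
    ring

/-- In the moments at c/Q^j the symbols (B;Q)_k cancel those of the polynomial. A terminating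
q-binomial series at Q^n/Q^j remains, and its value (Q^{-j};Q)_n vanishes for j < n. -/
lemma hasSum_meixner_shiftPoly (hQ0 : 0 < Q) (hQ1 : Q < 1) (hB0 : 0 < B) (hB1 : B < 1)
    (hc : 0 < c) (n j : ℕ) :
    HasSum (fun y => meixnerWeight B c Q y * meixner B c Q n y * (shiftPoly B c Q j).eval (Q ^ y)⁻¹)
      (qPochInf (-(c / Q ^ j)) Q * qPoch (Q ^ j)⁻¹ Q n) := by
  have hcj : 0 < c / Q ^ j := by positivity
  have h := hasSum_sum (s := Finset.range (n + 1)) fun k _ =>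
    (hasSum_meixnerWeight_mul_qPoch hQ0 hQ1 hcj k hB0 hB1).mul_left
      (qPoch (Q ^ n)⁻¹ Q k / qPoch Q Q k / qPoch B Q k * (-(Q ^ (n + 1) / c)) ^ k)
  have e1 : ∀ y, meixnerWeight B c Q y * meixner B c Q n y
        * (shiftPoly B c Q j).eval (Q ^ y)⁻¹
      = ∑ k ∈ Finset.range (n + 1),
        qPoch (Q ^ n)⁻¹ Q k / qPoch Q Q k / qPoch B Q k * (-(Q ^ (n + 1) / c)) ^ k
          * (meixnerWeight B (c / Q ^ j) Q y * qPoch (Q ^ y)⁻¹ Q k) := fun y => by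
    rw [mul_right_comm, meixnerWeight_mul_shiftPoly hQ0 hQ1, meixner_eq_sum hQ0.ne',
      Finset.mul_sum]
    exact Finset.sum_congr rfl fun k _ => by ring
  simp only [e1]
  have e2 : qPochInf (-(c / Q ^ j)) Q * qPoch (Q ^ j)⁻¹ Q n
      = ∑ k ∈ Finset.range (n + 1),
        qPoch (Q ^ n)⁻¹ Q k / qPoch Q Q k / qPoch B Q k * (-(Q ^ (n + 1) / c)) ^ k
          * (qPoch B Q k * (-(c / Q ^ j) / Q) ^ k * qPochInf (-(c / Q ^ j)) Q) := by
    have := sum_qPoch_div_qPoch hQ0 hQ1 n (Q ^ n / Q ^ j)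
    have hn : Q ^ n ≠ 0 := by positivity
    rw [show Q ^ n / Q ^ j * (Q ^ n)⁻¹ = (Q ^ j)⁻¹ by field_simp] at this
    rw [← this, Finset.mul_sum]
    refine Finset.sum_congr rfl fun k _ => ?_
    have hBk := (qPoch_pos hQ0 hQ1 hB1 k).ne'
    have e3 : (Q ^ n / Q ^ j) ^ k = (-(Q ^ (n + 1) / c)) ^ k * (-(c / Q ^ j) / Q) ^ k := by
      rw [← mul_pow]; congr 1; rw [pow_succ]; field_simp
    rw [e3]
    field_simp
  rw [e2]
  exact h

/-- Induction on the degree bound: subtracting the top coefficient times the monic `shiftPoly`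
lowers it. Only the step at degree n contributes, so the pairing reads off the coefficient of degree
n. -/
lemma hasSum_meixner_poly (hQ0 : 0 < Q) (hQ1 : Q < 1) (hB0 : 0 < B) (hB1 : B < 1)
    (hc : 0 < c) (n : ℕ) (d : ℕ) (hd : d ≤ n + 1) : ∀ P : ℝ[X], P.degree < d →
    HasSum (fun y => meixnerWeight B c Q y * meixner B c Q n y * P.eval (Q ^ y)⁻¹)
      (P.coeff n * (qPochInf (-(c / Q ^ n)) Q * qPoch (Q ^ n)⁻¹ Q n)) := by
  induction d with
  | zero =>
    intro P hP
    have : P = 0 := by simpa using hP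
    subst this
    simp
  | succ d ih =>
    intro P hP
    rw [degree_lt_iff_coeff_zero] at hP
    have hdeg := shiftPoly_natDegree (B := B) (c := c) (Q := Q) d
    have hlead : (shiftPoly B c Q d).coeff d = 1 := by
      have := (shiftPoly_monic (B := B) (c := c) (Q := Q) d).coeff_natDegree
      rwa [hdeg] at this
    have hR : (P - C (P.coeff d) * shiftPoly B c Q d).degree < d := by
      rw [degree_lt_iff_coeff_zero]
      intro m hm
      rw [coeff_sub, coeff_C_mul]
      rcases hm.eq_or_lt with rfl | hm
      · rw [hlead]; ring
      · rw [hP m hm, coeff_eq_zero_of_natDegree_lt (hdeg.trans_lt hm)]; ring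
    have h1 := ih (by omega) _ hR
    have h2 := (hasSum_meixner_shiftPoly hQ0 hQ1 hB0 hB1 hc n d).mul_left (P.coeff d)
    have h3 := h1.add h2
    have hval : qPochInf (-(c / Q ^ d)) Q * qPoch (Q ^ d)⁻¹ Q n
        = (shiftPoly B c Q d).coeff n * (qPochInf (-(c / Q ^ n)) Q * qPoch (Q ^ n)⁻¹ Q n) := by
      rcases (Nat.lt_succ_iff.1 hd).eq_or_lt with rfl | hlt
      · rw [hlead, one_mul]
      · have := qPoch_zpow_neg_eq_zero hQ0.ne' hlt
        rw [zpow_neg, zpow_natCast] at this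
        rw [this, coeff_eq_zero_of_natDegree_lt (hdeg.trans_lt hlt)]; ring
    rw [hval, coeff_sub, coeff_C_mul] at h3
    have e : ∀ y : ℕ, meixnerWeight B c Q y * meixner B c Q n y
          * (P - C (P.coeff d) * shiftPoly B c Q d).eval (Q ^ y)⁻¹
        + P.coeff d * (meixnerWeight B c Q y * meixner B c Q n y
          * (shiftPoly B c Q d).eval (Q ^ y)⁻¹)
        = meixnerWeight B c Q y * meixner B c Q n y * P.eval (Q ^ y)⁻¹ := fun y => by
      rw [eval_sub, eval_mul, eval_C]; ring
    simp only [e] at h3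
    rwa [← mul_assoc (P.coeff d), ← add_mul, sub_add_cancel] at h3

/-- `qPoch Y Q k` as a polynomial in `Y`. -/
noncomputable def qPochPoly (Q : ℝ) (k : ℕ) : ℝ[X] :=
  ∏ i ∈ Finset.range k, (1 - C (Q ^ i) * X)

lemma eval_qPochPoly (k : ℕ) (y : ℝ) : (qPochPoly Q k).eval y = qPoch y Q k := by
  rw [qPochPoly, eval_prod, qPoch]
  exact Finset.prod_congr rfl fun i _ => by simp [mul_comm]

lemma qPochPoly_natDegree_le (k : ℕ) : (qPochPoly Q k).natDegree ≤ k := by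
  induction k with
  | zero => simp [qPochPoly]
  | succ k ih =>
    rw [qPochPoly, Finset.prod_range_succ, ← qPochPoly]
    refine natDegree_mul_le.trans (add_le_add ih ?_)
    compute_degree

lemma qPochPoly_coeff (k : ℕ) : (qPochPoly Q k).coeff k = (-1) ^ k * Q ^ (k.choose 2) := by
  induction k with
  | zero => simp [qPochPoly]
  | succ k ih =>
    have h0 : (qPochPoly Q k).coeff (k + 1) = 0 :=
      coeff_eq_zero_of_natDegree_lt (Nat.lt_succ_of_le (qPochPoly_natDegree_le k))
    rw [qPochPoly, Finset.prod_range_succ, ← qPochPoly, mul_sub, mul_one, coeff_sub, h0,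
      mul_comm (C _) X, ← mul_assoc, coeff_mul_C, coeff_mul_X, ih, choose_succ_two, pow_add]
    ring

/-- The q-Meixner polynomial as a polynomial in `Q ^ (-y)`. -/
noncomputable def meixnerPoly (B c Q : ℝ) (n : ℕ) : ℝ[X] :=
  ∑ k ∈ Finset.range (n + 1),
    C (qPoch (Q ^ n)⁻¹ Q k / qPoch Q Q k / qPoch B Q k * (-(Q ^ (n + 1) / c)) ^ k) * qPochPoly Q k

lemma eval_meixnerPoly (hQ : Q ≠ 0) (n y : ℕ) :
    (meixnerPoly B c Q n).eval (Q ^ y)⁻¹ = meixner B c Q n y := by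
  rw [meixnerPoly, meixner_eq_sum hQ, eval_finsetSum]
  simp only [eval_mul, eval_C, eval_qPochPoly]

lemma meixnerPoly_natDegree_le (n : ℕ) : (meixnerPoly B c Q n).natDegree ≤ n := by
  refine natDegree_sum_le_of_forall_le _ _ fun k hk => ?_
  refine (natDegree_C_mul_le _ _).trans ((qPochPoly_natDegree_le k).trans ?_)
  have := Finset.mem_range.1 hk
  omega

lemma meixnerPoly_coeff (n : ℕ) : (meixnerPoly B c Q n).coeff n
    = qPoch (Q ^ n)⁻¹ Q n / qPoch Q Q n / qPoch B Q n * (-(Q ^ (n + 1) / c)) ^ n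
      * ((-1) ^ n * Q ^ (n.choose 2)) := by
  rw [meixnerPoly, finsetSum_coeff, Finset.sum_range_succ, Finset.sum_eq_zero, zero_add,
    coeff_C_mul, qPochPoly_coeff]
  intro k hk
  rw [coeff_C_mul, coeff_eq_zero_of_natDegree_lt, mul_zero]
  exact (qPochPoly_natDegree_le k).trans_lt (Finset.mem_range.1 hk)

/-- The squared norm of the q-Meixner polynomial. -/
noncomputable def meixnerNorm (B c Q : ℝ) (n : ℕ) : ℝ :=
  qPochInf (-(c / Q ^ n)) Q * (qPoch Q Q n / qPoch B Q n) * Q ^ (n.choose 2) / c ^ n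

lemma meixnerPoly_coeff_mul (hQ0 : 0 < Q) (hQ1 : Q < 1) (hB1 : B < 1) (hc : 0 < c) (n : ℕ) :
    (meixnerPoly B c Q n).coeff n * (qPochInf (-(c / Q ^ n)) Q * qPoch (Q ^ n)⁻¹ Q n)
      = meixnerNorm B c Q n := by
  have h1 := (qPoch_pos hQ0 hQ1 hQ1 n).ne'
  have h2 := (qPoch_pos hQ0 hQ1 hB1 n).ne'
  have h3 := qPoch_inv_pow_self hQ0 n
  have h4 : (Q ^ (n + 1)) ^ n = (Q ^ ((n + 1).choose 2)) ^ 2 := by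
    rw [← pow_mul, ← pow_mul]
    congr 1
    rw [Nat.choose_two_right]
    exact (Nat.div_mul_cancel (Nat.even_mul_pred_self (n + 1)).two_dvd).symm
  have h5 : ((-1 : ℝ) ^ n) ^ 2 = 1 := by rw [← pow_mul, mul_comm, pow_mul]; simp
  have h6 : (-(Q ^ (n + 1) / c)) ^ n = (-1) ^ n * (Q ^ ((n + 1).choose 2)) ^ 2 / c ^ n := by
    rw [neg_pow, div_pow, h4]; ring
  rw [meixnerPoly_coeff, h6, meixnerNorm]
  generalize qPoch (Q ^ n)⁻¹ Q n = a at *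
  generalize Q ^ ((n + 1).choose 2) = t at *
  generalize qPochInf (-(c / Q ^ n)) Q = p
  have hcn : c ^ n ≠ 0 := by positivity
  field_simp
  linear_combination p * (((-1) ^ n) ^ 2 * (a * t + (-1) ^ n * qPoch Q Q n) * h3
    + (qPoch Q Q n) ^ 2 * (((-1) ^ n) ^ 2 + 1) * h5)

/-- Orthogonality of the q-Meixner polynomials. -/
lemma hasSum_meixner_mul_meixner (hQ0 : 0 < Q) (hQ1 : Q < 1) (hB0 : 0 < B) (hB1 : B < 1)
    (hc : 0 < c) (m n : ℕ) :
    HasSum (fun y => meixnerWeight B c Q y * (meixner B c Q m y * meixner B c Q n y))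
      (if m = n then meixnerNorm B c Q n else 0) := by
  have key : ∀ {m n : ℕ}, m ≤ n →
      HasSum (fun y => meixnerWeight B c Q y * (meixner B c Q m y * meixner B c Q n y))
        (if m = n then meixnerNorm B c Q n else 0) := fun {m n} hmn => by
    -- The polynomial of lower degree is the test function, so only its coefficient of degree n
    -- matters; this is zero unless m = n.
    have h := hasSum_meixner_poly hQ0 hQ1 hB0 hB1 hc n (n + 1) le_rfl (meixnerPoly B c Q m)
      ((degree_le_natDegree).trans_lt (by
        exact_mod_cast Nat.lt_succ_of_le ((meixnerPoly_natDegree_le m).trans hmn)))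
    have e : ∀ y, meixnerWeight B c Q y * meixner B c Q n y * (meixnerPoly B c Q m).eval (Q ^ y)⁻¹
        = meixnerWeight B c Q y * (meixner B c Q m y * meixner B c Q n y) := fun y => by
      rw [eval_meixnerPoly hQ0.ne']; ring
    simp only [e] at h
    split_ifs with hmn'
    · subst hmn'
      rwa [meixnerPoly_coeff_mul hQ0 hQ1 hB1 hc] at h
    · rwa [coeff_eq_zero_of_natDegree_lt ((meixnerPoly_natDegree_le m).trans_lt
        (lt_of_le_of_ne hmn hmn')), zero_mul] at h
  rcases le_total m n with h | h
  · exact key h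
  · have := key h
    simp only [mul_comm (meixner B c Q n _)] at this
    by_cases hmn : m = n
    · subst hmn; exact this
    · rw [if_neg hmn]; rwa [if_neg (Ne.symm hmn)] at this

end

/-! ### Splitting off the last site -/

section

variable {L : ℕ}

/-- Append a site at the right end of a configuration. -/
def snocConfig (x : Config L) (k : ℕ) : Config (L + 1) := Fin.snoc (α := fun _ => ℕ) x k

lemma snocConfig_castSucc (x : Config L) (k : ℕ) (i : Fin L) :
    snocConfig x k i.castSucc = x i := by simp [snocConfig]

lemma snocConfig_last (x : Config L) (k : ℕ) : snocConfig x k (Fin.last L) = k := by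
  simp [snocConfig]

lemma mass_snocConfig (x : Config L) (k : ℕ) : mass (snocConfig x k) = mass x + k := by
  simp [mass, Fin.sum_univ_castSucc, snocConfig_castSucc, snocConfig_last]

lemma massLeft_snocConfig_castSucc (x : Config L) (k : ℕ) (i : Fin L) :
    massLeft (snocConfig x k) i.castSucc = massLeft x i := by
  have : ¬ Fin.last L < i.castSucc := not_lt.2 (Fin.le_last _)
  simp [massLeft, Finset.sum_filter, Fin.sum_univ_castSucc, snocConfig_castSucc, this]

lemma massLeft_snocConfig_last (x : Config L) (k : ℕ) :
    massLeft (snocConfig x k) (Fin.last L) = mass x := by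
  simp [massLeft, mass, Finset.sum_filter, Fin.sum_univ_castSucc, snocConfig_castSucc,
    Fin.castSucc_lt_last]

lemma massRight_snocConfig_castSucc (x : Config L) (k : ℕ) (i : Fin L) :
    massRight (snocConfig x k) i.castSucc = massRight x i + k := by
  simp [massRight, Finset.sum_filter, Fin.sum_univ_castSucc, snocConfig_castSucc,
    snocConfig_last, Fin.castSucc_lt_last]

lemma massRight_snocConfig_last (x : Config L) (k : ℕ) :
    massRight (snocConfig x k) (Fin.last L) = 0 := by
  refine Finset.sum_eq_zero fun m hm => ?_
  exact absurd (Finset.mem_filter.1 hm).2 (not_lt.2 (Fin.le_last m))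

/-- Configurations on `L + 1` sites as pairs. -/
def snocConfigEquiv (L : ℕ) : Config L × ℕ ≃ Config (L + 1) :=
  (Equiv.prodComm _ _).trans (Fin.snocEquiv fun _ => ℕ)

lemma exists_eq_snocConfig (x : Config (L + 1)) : ∃ y k, x = snocConfig y k :=
  ⟨((snocConfigEquiv L).symm x).1, ((snocConfigEquiv L).symm x).2,
    ((snocConfigEquiv L).apply_symm_apply x).symm⟩

lemma snocConfig_inj {x y : Config L} {k l : ℕ} :
    snocConfig x k = snocConfig y l ↔ x = y ∧ k = l := by
  have := (snocConfigEquiv L).injective.eq_iff (a := (x, k)) (b := (y, l))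
  rwa [Prod.mk.injEq] at this

end

/-! ### Last-site factorisation and multivariate orthogonality -/

section

variable {L : ℕ} {q θ α : ℝ}

/-- The last site sees all of `y` on its left and nothing on its right. Every earlier site sees `l`
further dual particles on its right, which divides α by Q^l. -/
lemma dualityFn_snocConfig (hq : 0 < q) (y n : Config L) (k l : ℕ) :
    dualityFn q θ α (snocConfig y k) (snocConfig n l)
      = dualityFn q θ (α / (q ^ 2) ^ l) y n
        * meixner (q ^ (2 * θ)) (α * (q ^ 2) ^ mass y * q ^ (θ * (2 * L + 1) + 1)) (q ^ 2) l k := by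
  rw [dualityFn_eq hq, dualityFn_eq hq, Fin.prod_univ_castSucc]
  congr 1
  · refine Finset.prod_congr rfl fun i _ => ?_
    rw [snocConfig_castSucc, snocConfig_castSucc, massLeft_snocConfig_castSucc,
      massRight_snocConfig_castSucc, siteFactor, siteFactor, siteArg, siteArg]
    congr 2
    rw [← add_assoc, Fin.val_castSucc, add_right_comm, pow_add _ _ l]
    rcases eq_or_ne α 0 with rfl | hα
    · simp
    have := (Real.rpow_pos_of_pos hq (θ * (2 * (i.val : ℝ) + 1) + 1)).ne'
    field_simp
  · rw [snocConfig_last, snocConfig_last, massLeft_snocConfig_last, massRight_snocConfig_last]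
    rfl

/-- [a]_q = q^{1-a}(1 - q^{2a})/(1 - q²); in each quotient the powers q^{-k} cancel and q^{1-θ} is
left. -/
lemma qBinom_eq (hq : 0 < q) (hq1 : q < 1) (m : ℕ) :
    qBinom q θ m = (q ^ (1 - θ)) ^ m * (qPoch (q ^ (2 * θ)) (q ^ 2) m / qPoch (q ^ 2) (q ^ 2) m) := by
  have hb : ∀ a : ℝ, bracketNum q a = q ^ (1 - a) * (1 - q ^ (2 * a)) / (1 - q ^ 2) := fun a => by
    have e1 : q ^ (1 - a) = q * q ^ (-a) := by
      rw [sub_eq_add_neg, Real.rpow_add hq, Real.rpow_one]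
    have e2 : q ^ (2 * a) = q ^ a * q ^ a := by rw [← Real.rpow_add hq]; congr 1; ring
    have e3 : q ^ (-a) * q ^ a = 1 := by rw [← Real.rpow_add hq]; simp
    have h1 : 1 - q ^ 2 ≠ 0 := by nlinarith
    have h2 : q - q⁻¹ = -(1 - q ^ 2) / q := by field_simp; ring
    rw [bracketNum, h2, e1, e2]
    field_simp
    linear_combination (q ^ a) * e3
  have h1 : 1 - q ^ 2 ≠ 0 := by nlinarith
  rw [qBinom, qFactorial, ← Finset.prod_div_distrib, qPoch, qPoch, ← Finset.prod_div_distrib,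
    show (q ^ (1 - θ)) ^ m = ∏ _k ∈ Finset.range m, q ^ (1 - θ) by simp,
    ← Finset.prod_mul_distrib]
  refine Finset.prod_congr rfl fun k _ => ?_
  have e1 : q ^ (1 - (θ + k)) = q ^ (1 - θ) * q ^ (-(k : ℝ)) := by
    rw [← Real.rpow_add hq]; congr 1; ring
  have e2 : q ^ (2 * (θ + k)) = q ^ (2 * θ) * (q ^ 2) ^ k := by
    rw [← pow_mul, ← Real.rpow_natCast, ← Real.rpow_add hq]; push_cast; congr 1; ring
  have e3 : q ^ (1 - ((k : ℝ) + 1)) = q ^ (-(k : ℝ)) := by congr 1; ring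
  have e4 : q ^ (2 * ((k : ℝ) + 1)) = q ^ 2 * (q ^ 2) ^ k := by
    rw [← pow_succ', ← pow_mul, ← Real.rpow_natCast]; push_cast; congr 1
  have h2 := (Real.rpow_pos_of_pos hq (-(k : ℝ))).ne'
  have h3 : 1 - q ^ 2 * (q ^ 2) ^ k ≠ 0 := by
    rw [← pow_succ', sub_ne_zero]
    exact (pow_lt_one₀ (by positivity) (by nlinarith) (Nat.succ_ne_zero k)).ne'
  rw [hb, hb, e1, e2, e3, e4]
  generalize 1 - q ^ 2 * (q ^ 2) ^ k = d at *
  field_simp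

lemma rpow_mul_sub_one (N : ℕ) :
    q ^ ((N : ℝ) * ((N : ℝ) - 1)) = (q ^ 2) ^ (N.choose 2) := by
  rw [← pow_mul, ← Real.rpow_natCast]
  congr 1
  push_cast
  rw [Nat.cast_choose_two]
  ring

lemma add_choose_two (a b : ℕ) : (a + b).choose 2 = a.choose 2 + a * b + b.choose 2 := by
  induction b with
  | zero => simp
  | succ b ih => rw [← add_assoc, choose_succ_two, ih, choose_succ_two]; ring

lemma mu_site (hq : 0 < q) (hq1 : q < 1) (i m : ℕ) :
    α ^ m * qBinom q θ m * q ^ (2 * θ * ((i : ℝ) + 1) * (m : ℝ))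
      = (α * q ^ (θ * (2 * i + 1) + 1)) ^ m
        * (qPoch (q ^ (2 * θ)) (q ^ 2) m / qPoch (q ^ 2) (q ^ 2) m) := by
  have e : q ^ (2 * θ * ((i : ℝ) + 1) * (m : ℝ)) * (q ^ (1 - θ)) ^ m
      = (q ^ (θ * (2 * i + 1) + 1)) ^ m := by
    rw [Real.rpow_mul_natCast hq.le, ← mul_pow, ← Real.rpow_add hq]
    congr 2; ring
  rw [qBinom_eq hq hq1, mul_pow, ← e]
  ring

lemma mu_snocConfig (hq : 0 < q) (hq1 : q < 1) (x : Config L) (k : ℕ) :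
    mu q θ α (snocConfig x k) = mu q θ α x * ((α * q ^ (θ * (2 * L + 1) + 1)) ^ k
        * (qPoch (q ^ (2 * θ)) (q ^ 2) k / qPoch (q ^ 2) (q ^ 2) k)) := by
  rw [mu, Fin.prod_univ_castSucc, snocConfig_last, Fin.val_last, mu_site hq hq1]
  simp only [snocConfig_castSucc, Fin.val_castSucc]
  rfl

lemma mu_div (hq : 0 < q) (x : Config L) (l : ℕ) :
    mu q θ (α / (q ^ 2) ^ l) x * (q ^ 2) ^ (l * mass x) = mu q θ α x := by
  rw [mu, mu, mass, pow_mul, ← Finset.prod_pow_eq_pow_sum, ← Finset.prod_mul_distrib]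
  refine Finset.prod_congr rfl fun i _ => ?_
  rw [div_pow]
  field_simp

lemma mu_pos (hq : 0 < q) (hq1 : q < 1) (hθ : 0 < θ) (hα : 0 < α) (x : Config L) :
    0 < mu q θ α x := by
  refine Finset.prod_pos fun i _ => ?_
  rw [mu_site hq hq1]
  have h1 := Real.rpow_pos_of_pos hq (θ * (2 * (i.val : ℝ) + 1) + 1)
  have h2 := qPoch_pos (a := q ^ (2 * θ)) (Q := q ^ 2) (by positivity) (by nlinarith)
    (Real.rpow_lt_one hq.le hq1 (by positivity)) (x i)
  have h3 := qPoch_pos (a := q ^ 2) (Q := q ^ 2) (by positivity) (by nlinarith)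
    (by nlinarith) (x i)
  positivity

lemma pochX_eq (hq : 0 < q) (x : Config L) :
    pochX q θ α x
      = qPochInf (-(α * (q ^ 2) ^ mass x * q ^ (θ * (2 * L + 1) + 1))) (q ^ 2) := by
  rw [pochX, ← pow_mul, ← Real.rpow_natCast q (2 * mass x), mul_assoc α, ← Real.rpow_add hq,
    neg_mul]
  congr 3
  push_cast
  ring_nf

lemma pochN_eq (hq : 0 < q) (x : Config L) :
    pochN q θ α x = qPochInf (-(α / (q ^ 2) ^ mass x * q ^ (1 + θ))) (q ^ 2) := by
  have : q ^ (1 - 2 * (mass x : ℝ) + θ) = q ^ (1 + θ) / (q ^ 2) ^ mass x := by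
    rw [← pow_mul, ← Real.rpow_natCast, ← Real.rpow_sub hq]
    congr 1
    push_cast
    ring
  rw [pochN, this]
  congr 1
  ring

lemma one_le_pochX (hq : 0 < q) (hq1 : q < 1) (hα : 0 < α) (x : Config L) :
    1 ≤ pochX q θ α x := by
  rw [pochX_eq hq]
  have := Real.rpow_pos_of_pos hq (θ * (2 * L + 1) + 1)
  have : 0 < α * (q ^ 2) ^ mass x * q ^ (θ * (2 * L + 1) + 1) := by positivity
  exact one_le_qPochInf (by positivity) (by nlinarith) (by linarith)

lemma weight_pos (hq : 0 < q) (hq1 : q < 1) (hθ : 0 < θ) (hα : 0 < α) (x : Config L) :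
    0 < weight q θ α x := by
  have h1 := mu_pos hq hq1 hθ hα x
  have h2 := one_le_pochX (θ := θ) hq hq1 hα x
  exact mul_pos (mul_pos h1 (Real.rpow_pos_of_pos hq _)) (by linarith)

/-- The cross term in C(N+k,2) = C(N,2) + Nk + C(k,2) gives (Q^N)^k, which joins α^k and makes the
q-Meixner parameter depend on the mass N of `y`. -/
lemma weight_snocConfig (hq : 0 < q) (hq1 : q < 1) (y : Config L) (k : ℕ) :
    weight q θ α (snocConfig y k) = mu q θ α y * (q ^ 2) ^ ((mass y).choose 2)
      * meixnerWeight (q ^ (2 * θ)) (α * (q ^ 2) ^ mass y * q ^ (θ * (2 * L + 1) + 1)) (q ^ 2) k := by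
  have e : q ^ (θ * (2 * ((L + 1 : ℕ) : ℝ) + 1) + 1)
      = q ^ (θ * (2 * L + 1) + 1) * q ^ (2 * θ) := by
    rw [← Real.rpow_add hq]; push_cast; congr 1; ring
  rw [weight, rpow_mul_sub_one, mass_snocConfig, add_choose_two, mu_snocConfig hq hq1,
    pochX_eq hq, mass_snocConfig, e, meixnerWeight, meixnerPreweight, pow_add, pow_add, pow_mul,
    mul_pow _ _ k, mul_pow _ _ k, mul_pow _ _ k, pow_add _ (mass y) k]
  rw [show -(α * ((q ^ 2) ^ mass y * (q ^ 2) ^ k) * (q ^ (θ * (2 * L + 1) + 1) * q ^ (2 * θ)))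
    = -(α * (q ^ 2) ^ mass y * q ^ (θ * (2 * L + 1) + 1) * q ^ (2 * θ) * (q ^ 2) ^ k) by ring]
  ring

/-- The factor contributed by the last site to the squared norm of the duality function. -/
noncomputable def siteNorm (q θ α : ℝ) (L l : ℕ) : ℝ :=
  qPoch (q ^ 2) (q ^ 2) l / qPoch (q ^ (2 * θ)) (q ^ 2) l * (q ^ 2) ^ (l.choose 2)
    / (α * q ^ (θ * (2 * L + 1) + 1)) ^ l

/-- The infinite product of the q-Meixner norm, taken at c/Q^l, is exactly the `pochX` factor of the
L-site weight with α/Q^l. The remaining power of Q^N converts `mu` to the same parameter. -/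
lemma meixnerNorm_eq (hq : 0 < q) (hα : 0 < α) (y : Config L) (l : ℕ) :
    mu q θ α y * (q ^ 2) ^ ((mass y).choose 2)
      * meixnerNorm (q ^ (2 * θ)) (α * (q ^ 2) ^ mass y * q ^ (θ * (2 * L + 1) + 1)) (q ^ 2) l
      = siteNorm q θ α L l * weight q θ (α / (q ^ 2) ^ l) y := by
  rw [meixnerNorm, siteNorm, weight, rpow_mul_sub_one, pochX_eq hq, ← mu_div hq y l,
    show α / (q ^ 2) ^ l * (q ^ 2) ^ mass y * q ^ (θ * (2 * L + 1) + 1)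
      = α * (q ^ 2) ^ mass y * q ^ (θ * (2 * L + 1) + 1) / (q ^ 2) ^ l by ring,
    mul_comm l, pow_mul _ (mass y), mul_right_comm α, mul_pow _ ((q ^ 2) ^ mass y)]
  have h1 : 0 < q ^ (θ * (2 * L + 1) + 1) := Real.rpow_pos_of_pos hq _
  have hw : ((q ^ 2) ^ mass y) ^ l ≠ 0 := by positivity
  generalize ((q ^ 2) ^ mass y) ^ l = w at *
  field_simp

/-- The value of `∑ D(y, n)² w(y)`. -/
noncomputable def dualityNorm (q θ α : ℝ) (n : Config L) : ℝ :=
  (q ^ 2) ^ ((mass n).choose 2) * pochN q θ α n / mu q θ α n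

lemma dualityNorm_snocConfig (hq : 0 < q) (hq1 : q < 1) (hθ : 0 < θ) (hα : 0 < α) (n : Config L)
    (l : ℕ) : dualityNorm q θ α (snocConfig n l)
      = siteNorm q θ α L l * dualityNorm q θ (α / (q ^ 2) ^ l) n := by
  have h1 := mu_pos hq hq1 hθ (show 0 < α / (q ^ 2) ^ l by positivity) n
  have h3 := Real.rpow_pos_of_pos hq (θ * (2 * L + 1) + 1)
  have h4 := qPoch_pos (a := q ^ (2 * θ)) (Q := q ^ 2) (by positivity) (by nlinarith)
    (Real.rpow_lt_one hq.le hq1 (by positivity)) l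
  have h5 := qPoch_pos (a := q ^ 2) (Q := q ^ 2) (by positivity) (by nlinarith)
    (by nlinarith) l
  have e : pochN q θ α (snocConfig n l) = pochN q θ (α / (q ^ 2) ^ l) n := by
    rw [pochN_eq hq, pochN_eq hq, mass_snocConfig, pow_add]
    congr 2
    field_simp
  rw [dualityNorm, dualityNorm, siteNorm, e, mass_snocConfig, add_choose_two,
    mu_snocConfig hq hq1, ← mu_div hq n l, mul_comm l, pow_add, pow_add]
  generalize qPoch (q ^ (2 * θ)) (q ^ 2) l = b at *
  generalize qPoch (q ^ 2) (q ^ 2) l = d at *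
  generalize mu q θ (α / (q ^ 2) ^ l) n = m at *
  generalize q ^ (θ * (2 * L + 1) + 1) = t at *
  have h6 : 0 < α * t := by positivity
  generalize α * t = u at *
  field_simp

/-- Orthogonality of the duality functions with respect to the unnormalised weight. -/
lemma hasSum_dualityFn_mul (hq : 0 < q) (hq1 : q < 1) (hθ : 0 < θ) :
    ∀ {L : ℕ} {α : ℝ}, 0 < α → ∀ x n : Config L,
      HasSum (fun y => dualityFn q θ α y x * dualityFn q θ α y n * weight q θ α y)
        (if x = n then dualityNorm q θ α n else 0) := by
  have hQ0 : 0 < q ^ 2 := by positivity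
  have hQ1 : q ^ 2 < 1 := by nlinarith
  have hB0 : 0 < q ^ (2 * θ) := Real.rpow_pos_of_pos hq _
  have hB1 : q ^ (2 * θ) < 1 := Real.rpow_lt_one hq.le hq1 (by positivity)
  intro L
  -- α stays quantified, as the induction hypothesis is used at α/Q^l.
  induction L with
  | zero =>
    intro α hα x n
    have hx : x = n := Subsingleton.elim _ _
    rw [if_pos hx]
    have h := hasSum_unique fun y : Config 0 =>
      dualityFn q θ α y x * dualityFn q θ α y n * weight q θ α y
    convert h using 1
    rw [weight, pochX_eq hq, dualityNorm, pochN_eq hq]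
    simp [dualityFn, mu, mass, add_comm]
  | succ L ih =>
    intro α hα x n
    have hterm : ∀ (x n y : Config L) (k l j : ℕ),
        dualityFn q θ α (snocConfig y j) (snocConfig x k)
          * dualityFn q θ α (snocConfig y j) (snocConfig n l) * weight q θ α (snocConfig y j)
        = dualityFn q θ (α / (q ^ 2) ^ k) y x * dualityFn q θ (α / (q ^ 2) ^ l) y n
          * (mu q θ α y * (q ^ 2) ^ ((mass y).choose 2))
          * (meixnerWeight (q ^ (2 * θ)) (α * (q ^ 2) ^ mass y * q ^ (θ * (2 * L + 1) + 1)) (q ^ 2) j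
            * (meixner (q ^ (2 * θ)) (α * (q ^ 2) ^ mass y * q ^ (θ * (2 * L + 1) + 1)) (q ^ 2) k j
              * meixner (q ^ (2 * θ)) (α * (q ^ 2) ^ mass y * q ^ (θ * (2 * L + 1) + 1))
                (q ^ 2) l j)) := by
      intro x n y k l j
      rw [dualityFn_snocConfig hq, dualityFn_snocConfig hq, weight_snocConfig hq hq1]
      ring
    -- If k ≠ l the sum over the last coordinate vanishes for every y, so the different parameters
    -- α/Q^k and α/Q^l of the remaining factors do not matter.
    have hinner : ∀ (x n y : Config L) (k l : ℕ), HasSum (fun j =>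
        dualityFn q θ α (snocConfig y j) (snocConfig x k)
          * dualityFn q θ α (snocConfig y j) (snocConfig n l) * weight q θ α (snocConfig y j))
        (if k = l then siteNorm q θ α L l * (dualityFn q θ (α / (q ^ 2) ^ l) y x
          * dualityFn q θ (α / (q ^ 2) ^ l) y n * weight q θ (α / (q ^ 2) ^ l) y) else 0) := by
      intro x n y k l
      have hc : 0 < α * (q ^ 2) ^ mass y * q ^ (θ * (2 * L + 1) + 1) := by
        have := Real.rpow_pos_of_pos hq (θ * (2 * L + 1) + 1)
        positivity
      have h := (hasSum_meixner_mul_meixner hQ0 hQ1 hB0 hB1 hc k l).mul_left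
        (dualityFn q θ (α / (q ^ 2) ^ k) y x * dualityFn q θ (α / (q ^ 2) ^ l) y n
          * (mu q θ α y * (q ^ 2) ^ ((mass y).choose 2)))
      simp only [← hterm] at h
      split_ifs with hkl
      · subst hkl
        rw [if_pos rfl, mul_assoc, meixnerNorm_eq hq hα] at h
        rwa [mul_left_comm] at h
      · rwa [if_neg hkl, mul_zero] at h
    have houter : ∀ (x n : Config L) (k l : ℕ), HasSum (fun y =>
        if k = l then siteNorm q θ α L l * (dualityFn q θ (α / (q ^ 2) ^ l) y x
          * dualityFn q θ (α / (q ^ 2) ^ l) y n * weight q θ (α / (q ^ 2) ^ l) y) else 0)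
        (if snocConfig x k = snocConfig n l then dualityNorm q θ α (snocConfig n l) else 0) := by
      intro x n k l
      by_cases hkl : k = l
      · subst hkl
        have h := (ih (show 0 < α / (q ^ 2) ^ k by positivity) x n).mul_left (siteNorm q θ α L k)
        simpa [snocConfig_inj, dualityNorm_snocConfig hq hq1 hθ hα, mul_ite] using h
      · simp [snocConfig_inj, hkl]
    -- For squares the terms are nonnegative, so convergence of the iterated sums gives joint
    -- summability.
    have hdiag : ∀ (n : Config L) (l : ℕ), Summable fun p : Config L × ℕ =>
        dualityFn q θ α (snocConfig p.1 p.2) (snocConfig n l)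
          * dualityFn q θ α (snocConfig p.1 p.2) (snocConfig n l)
          * weight q θ α (snocConfig p.1 p.2) := by
      intro n l
      rw [summable_prod_of_nonneg fun p =>
        mul_nonneg (mul_self_nonneg _) (weight_pos hq hq1 hθ hα _).le]
      refine ⟨fun y => (hinner n n y l l).summable, ?_⟩
      exact (houter n n l l).summable.congr fun y => (hinner n n y l l).tsum_eq.symm
    obtain ⟨x, k, rfl⟩ := exists_eq_snocConfig x
    obtain ⟨n, l, rfl⟩ := exists_eq_snocConfig n
    rw [← (snocConfigEquiv L).hasSum_iff]
    -- Mixed products are dominated by |ab| ≤ a² + b²; only then may the joint sum be computed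
    -- fibrewise.
    have hsum : Summable fun p : Config L × ℕ =>
        dualityFn q θ α (snocConfig p.1 p.2) (snocConfig x k)
          * dualityFn q θ α (snocConfig p.1 p.2) (snocConfig n l)
          * weight q θ α (snocConfig p.1 p.2) := by
      refine ((hdiag x k).add (hdiag n l)).of_norm_bounded fun p => ?_
      have hw := (weight_pos hq hq1 hθ hα (snocConfig p.1 p.2)).le
      rw [Real.norm_eq_abs, abs_mul, abs_of_nonneg hw, ← add_mul]
      refine mul_le_mul_of_nonneg_right ?_ hw
      rw [abs_le]
      constructor <;> nlinarith [sq_nonneg (dualityFn q θ α (snocConfig p.1 p.2) (snocConfig x k)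
        + dualityFn q θ α (snocConfig p.1 p.2) (snocConfig n l)),
        sq_nonneg (dualityFn q θ α (snocConfig p.1 p.2) (snocConfig x k)
        - dualityFn q θ α (snocConfig p.1 p.2) (snocConfig n l)),
        sq_nonneg (dualityFn q θ α (snocConfig p.1 p.2) (snocConfig x k)),
        sq_nonneg (dualityFn q θ α (snocConfig p.1 p.2) (snocConfig n l))]
    have h := hsum.hasSum
    have := (h.prod_fiberwise fun y => hinner x n y k l).unique (houter x n k l)
    rw [← this]
    exact h

end

/-! ### Normalisation -/

section

variable {L : ℕ} {q θ α : ℝ}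

lemma dualityFn_zero_right (hq : 0 < q) (x : Config L) : dualityFn q θ α x 0 = 1 := by
  rw [dualityFn_eq hq]
  refine Finset.prod_eq_one fun i _ => ?_
  have h := phi21_eq_sum (a := ((q ^ 2) ^ x i)⁻¹) (c := q ^ (2 * θ)) (Q := q ^ 2)
    (z := siteArg q θ α i (massLeft x i) ((0 : Config L) i + massRight (0 : Config L) i))
    (by positivity) 0
  rw [siteFactor]
  simpa [phiCoeff, qPoch_zero] using h

/-- The duality function with `n = 0` is identically 1, so the total mass is its squared norm. -/
lemma hasSum_weight (hq : 0 < q) (hq1 : q < 1) (hθ : 0 < θ) (hα : 0 < α) :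
    HasSum (weight (L := L) q θ α) (dualityNorm q θ α (0 : Config L)) := by
  have h := hasSum_dualityFn_mul hq hq1 hθ hα (0 : Config L) 0
  simpa only [dualityFn_zero_right hq, one_mul, if_pos] using h

lemma partitionFn_pos (hq : 0 < q) (hq1 : q < 1) (hθ : 0 < θ) (hα : 0 < α) :
    0 < partitionFn q θ α L :=
  (hasSum_weight hq hq1 hθ hα).summable.tsum_pos
    (fun x => (weight_pos hq hq1 hθ hα x).le) 0 (weight_pos hq hq1 hθ hα 0)

/-- The factor `pochX`, one power of the partition function and one factor Q^{C(N,2)} cancel. -/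
lemma gFn_div_omega (hq : 0 < q) (hq1 : q < 1) (hθ : 0 < θ) (hα : 0 < α) (n : Config L) :
    gFn q θ α n / omega q θ α n = dualityNorm q θ α n / partitionFn q θ α L := by
  have hZ := partitionFn_pos (L := L) hq hq1 hθ hα
  have hm := mu_pos hq hq1 hθ hα n
  have hX : 0 < pochX q θ α n := by linarith [one_le_pochX (θ := θ) hq hq1 hα n]
  have e : q ^ (2 * (mass n : ℝ) * ((mass n : ℝ) - 1)) = ((q ^ 2) ^ ((mass n).choose 2)) ^ 2 := by
    rw [← rpow_mul_sub_one, ← Real.rpow_mul_natCast hq.le]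
    congr 1; push_cast; ring
  rw [gFn, omega, weight, dualityNorm, e, rpow_mul_sub_one]
  have hp : 0 < (q ^ 2) ^ ((mass n).choose 2) := by positivity
  generalize (q ^ 2) ^ ((mass n).choose 2) = p at *
  field_simp

end

end ASIP

theorem theorem3p2 (q θ α : ℝ) (hq0 : 0 < q) (hq1 : q < 1) (hθ : 0 < θ)
    (hα0 : 0 < α) (hα1 : α < q ^ (-1 - θ)) (L : ℕ) (hL : 1 ≤ L) :
    -- the generator determines the process in law, and the process is self-dual
    (∃ κ : ℝ≥0 → Kernel (ASIP.Config L) (ASIP.Config L),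
      ASIP.IsTransitionSemigroup (ASIP.generator q θ) κ ∧
      (∀ κ' : ℝ≥0 → Kernel (ASIP.Config L) (ASIP.Config L),
        ASIP.IsTransitionSemigroup (ASIP.generator q θ) κ' → κ' = κ) ∧
      ASIP.SemigroupSelfDual κ (ASIP.dualityFn q θ α) ∧
      ∀ {Ω Ω' : Type*} [MeasurableSpace Ω] [MeasurableSpace Ω']
        (P : ASIP.Config L → Measure Ω) (X : ℝ≥0 → Ω → ASIP.Config L)
        (P' : ASIP.Config L → Measure Ω') (X' : ℝ≥0 → Ω' → ASIP.Config L),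
        ASIP.IsMarkovProcess κ P X → ASIP.IsMarkovProcess κ P' X' →
        ASIP.AreDual P X P' X' (ASIP.dualityFn q θ α)) ∧
    -- `ω_α` is a probability measure that charges every configuration
    (∀ x : ASIP.Config L, 0 < ASIP.omega q θ α x) ∧
    HasSum (fun x : ASIP.Config L => ASIP.omega q θ α x) 1 ∧
    -- orthogonality in `L²(ω_α)` with the stated squared norms
    ∀ x n : ASIP.Config L,
      HasSum (fun y : ASIP.Config L =>
          ASIP.dualityFn q θ α y x * ASIP.dualityFn q θ α y n * ASIP.omega q θ α y)
        (if x = n then ASIP.gFn q θ α x / ASIP.omega q θ α x else 0) := by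
  have hG := ASIP.generator_isFiberGenerator (L := L) hq0 hq1 hθ
  have hZ := ASIP.partitionFn_pos (L := L) hq0 hq1 hθ hα0
  have hD := hG.semigroupSelfDual (ASIP.generator_duality (α := α) hq0 hq1 hθ)
  refine ⟨⟨ASIP.fiberKernel (ASIP.generator q θ) ASIP.mass, hG.isTransitionSemigroup,
    fun κ' h => hG.eq_fiberKernel h, hD, ?_⟩, fun x => ?_, ?_, fun x n => ?_⟩
  · intro Ω Ω' _ _ P X P' X' hX hX'
    exact hD.areDual hX hX'
  · exact div_pos (ASIP.weight_pos hq0 hq1 hθ hα0 x) hZ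
  · have h := (ASIP.hasSum_weight (L := L) hq0 hq1 hθ hα0).summable.hasSum.div_const
      (ASIP.partitionFn q θ α L)
    rwa [← ASIP.partitionFn, div_self hZ.ne'] at h
  · have h := (ASIP.hasSum_dualityFn_mul hq0 hq1 hθ hα0 x n).div_const (ASIP.partitionFn q θ α L)
    simp only [mul_div_assoc] at h
    by_cases hxn : x = n
    · subst hxn
      rw [if_pos rfl] at h ⊢
      rw [ASIP.gFn_div_omega hq0 hq1 hθ hα0]
      exact h
    · rw [if_neg hxn, zero_div] at h
      rw [if_neg hxn]
      exact h
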